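/- Let $K:\mathbb R\to[0,\infty)$ be an even Lipschitz function supported in $[-1,1]$ with $\int K=1$, $K\le K_{\max}<\infty$, and $K\ge K_{\min}>0$ on $[-\Delta,\Delta]$ for some $K_{\min},\Delta>0$; put $\mu_2=\int K^2$. For $n\ge 2$ let $x_i=i/n$ and $Y_i=f(x_i)+\varepsilon_i$, $i\in[n]=\{1,\dots,n\}$, with $\varepsilon_i$ i.i.d. $N(0,\sigma^2)$, $\sigma>0$ known. For $\beta\in(0,2]$ and $L>0$ let $\Sigma(\beta,L)$ be the set of $f:[0,1]\to\mathbb R$ that are $\lceil\beta\rceil-1$ times differentiable with $|f^{(\lceil\beta\rceil-1)}(x)-f^{(\lceil\beta\rceil-1)}(y)|\le L|x-y|^{\beta+1-\lceil\beta\rceil}$ for all $x,y\in[0,1]$. For $h>0$ let $\hat f_n(x;h)$ be the local linear estimator, i.e. $\hat f_n(x;h)=\hat\theta_0$ for a minimiser $\hat\theta=(\hat\theta_0,\hat\theta_1)$ of $\sum_{i}\bigl(Y_i-\theta_0-\theta_1\tfrac{x_i-x}{h}\bigr)^2K\bigl(\tfrac{x_i-x}{h}\bigr)$ (at the design points this value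 does not depend on the choice of the minimiser). For $\mathcal A\subseteq[n]$ let $d_{\mathcal A}(g,g')=\max_{i\in\mathcal A}|g(x_i)-g'(x_i)|$. Let $h_m=4^{m-1}/n$ for $m=1,\dots,M$, where $M=\max\{1,\lfloor\frac45\log_4 n+\frac15\log_4\log n\rfloor\}$, and $\hat f_{n,m}=\hat f_n(\cdot;h_m)$. For $\lambda_0>0$ put $C_\rho=\sqrt{32\sigma^2\mu_2/\lambda_0^2}$ and $G_2(h)=C_\rho\sqrt{\log n/(nh)}$. For $\kappa>1$ the CALM stopping index is $$\bar m=\min\{m\le M:\ d_{\mathcal A}(\hat f_{n,k},\hat f_{n,m})>4\kappa\, G_2(h_k)\text{ for some }1\le k<m\}-1,$$ and $\bar m=M$ if there is no such $m$. Then there is $\lambda_K>0$, depending only on $K$ (and $K_{\max}$), such that the following holds for all $\lambda_0\in(0,\lambda_K]$ and all $\sigma>0$. (i) For all $n\ge2$, $h\in(0,1/2]$, $\mathcal A\subseteq[n]$ and $f:[0,1]\to\mathbb R$, $\ \mathbb E\bigl[\max_{i\in\mathcal A}|\hat f_n(x_i;h)-\mathbb E\hat f_n(x_i;h)|^2\bigr]\le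 G_2(h)^2$. (ii) For all $\kappa>1$ and $L>0$ there is a constant $C_{\max}>0$, depending only on $K,K_{\max},\lambda_0,\sigma,\kappa,L$, such that for all $\beta\in(0,2]$ and all $n\ge2$ $$\inf_{\mathcal A\subseteq[n]}\ \inf_{f\in\Sigma(\beta,L)}\mathbb P\Bigl(d_{\mathcal A}(f,\hat f_{n,\bar m})\le C_{\max}\Bigl(\frac{\log n}{n}\Bigr)^{\frac{\beta}{2\beta+1}}\Bigr)\ \ge\ 1-n^{-\frac{\mu_2}{4K_{\max}^2}(\kappa-1)^2}\log n .$$ -/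

import Mathlib

open MeasureTheory ProbabilityTheory Set
open scoped NNReal ENNReal

noncomputable section

namespace CALM

/-- A kernel: non-negative, of total mass one, supported in `[-1, 1]`, bounded below by a positive
constant near the origin, bounded above by `Kmax`, Lipschitz continuous on the line, and even. -/
structure IsKernel (K : ℝ → ℝ) (Kmax : ℝ) : Prop where
  nonneg : ∀ u, 0 ≤ K u
  integral_eq_one : ∫ u, K u = 1
  support_subset : Function.support K ⊆ Icc (-1) 1
  lower : ∃ Kmin > 0, ∃ Δ > 0, ∀ u, |u| ≤ Δ → Kmin ≤ K u
  upper : ∀ u, K u ≤ Kmax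
  lipschitz : ∃ LK > 0, ∀ u v, |K u - K v| ≤ LK * |u - v|
  even : ∀ u, K (-u) = K u

/-- `μ₂ = ∫ K²`. -/
def mu2 (K : ℝ → ℝ) : ℝ := ∫ u, K u ^ 2

/-- The Hölder class of order `β > 0` and radius `L` on `[0, 1]`. With `k = ⌈β⌉ - 1`, its members are
`k` times differentiable on `[0, 1]` (one-sided at the end points) and the `k`-th derivative is Hölder
continuous with exponent `β - k` and constant `L`. Values outside `[0, 1]` play no role. -/
def holderClass (β L : ℝ) : Set (ℝ → ℝ) :=
  {f | ContDiffOn ℝ ((⌈β⌉₊ - 1 : ℕ) : WithTop ℕ∞) f (Icc 0 1) ∧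
    ∀ x ∈ Icc (0 : ℝ) 1, ∀ y ∈ Icc (0 : ℝ) 1,
      |iteratedDerivWithin (⌈β⌉₊ - 1) f (Icc 0 1) x
        - iteratedDerivWithin (⌈β⌉₊ - 1) f (Icc 0 1) y| ≤ L * |x - y| ^ (β + 1 - (⌈β⌉₊ : ℝ))}

/-- The design points `1/n, 2/n, …, n/n`, indexed from `0`. -/
def design (n : ℕ) (i : Fin n) : ℝ := ((i : ℝ) + 1) / n

/-- `U(u) = (1, u, u²/2!, …, uᵏ/k!)`. -/
def polyVec (k : ℕ) (u : ℝ) (j : Fin (k + 1)) : ℝ := u ^ (j : ℕ) / (Nat.factorial j : ℝ)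

/-- The weighted least squares criterion of the local polynomial fit of order `k` at `x`. -/
def lpeCriterion (K : ℝ → ℝ) (k : ℕ) {n : ℕ} (Y : Fin n → ℝ) (h x : ℝ) (θ : Fin (k + 1) → ℝ) : ℝ :=
  ∑ i, (Y i - ∑ j, θ j * polyVec k ((design n i - x) / h) j) ^ 2 * K ((design n i - x) / h)

open Classical in
/-- A minimiser of the local least squares criterion. -/
def lpeCoeff (K : ℝ → ℝ) (k : ℕ) {n : ℕ} (Y : Fin n → ℝ) (h x : ℝ) : Fin (k + 1) → ℝ :=
  if H : ∃ θ, IsMinOn (lpeCriterion K k Y h x) univ θ then H.choose else 0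

/-- The local polynomial estimator of order `k` with bandwidth `h`, at the point `x`: the value
`⟨θ, U(0)⟩` for a minimiser `θ`. -/
def lpe (K : ℝ → ℝ) (k : ℕ) {n : ℕ} (Y : Fin n → ℝ) (h x : ℝ) : ℝ :=
  ∑ j, lpeCoeff K k Y h x j * polyVec k 0 j

/-- At a design point, and for a kernel that is positive at the origin, the value `⟨θ, U(0)⟩` is the
same for all minimisers `θ`, so that `lpe` does not depend on the choice made in `lpeCoeff`, even
if the minimiser itself is not unique. -/
theorem lpe_value_unique (K : ℝ → ℝ) (hK : ∀ u, 0 ≤ K u) (hK0 : 0 < K 0) (k : ℕ) {n : ℕ}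
    (Y : Fin n → ℝ) (h : ℝ) (i : Fin n) (θ θ' : Fin (k + 1) → ℝ)
    (hθ : IsMinOn (lpeCriterion K k Y h (design n i)) univ θ)
    (hθ' : IsMinOn (lpeCriterion K k Y h (design n i)) univ θ') :
    ∑ j, θ j * polyVec k 0 j = ∑ j, θ' j * polyVec k 0 j := by
  set x := design n i with hx
  set p : Fin n → Fin (k + 1) → ℝ := fun l => polyVec k ((design n l - x) / h) with hp
  set w : Fin n → ℝ := fun l => K ((design n l - x) / h) with hw
  set η : Fin (k + 1) → ℝ := fun j => (θ j + θ' j) / 2 with hη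
  have e1 : ∀ l, ∑ j, η j * p l j = ((∑ j, θ j * p l j) + ∑ j, θ' j * p l j) / 2 := by
    intro l
    rw [← Finset.sum_add_distrib, Finset.sum_div]
    exact Finset.sum_congr rfl fun j _ => by simp only [hη]; ring
  have key : lpeCriterion K k Y h x η
      = (lpeCriterion K k Y h x θ + lpeCriterion K k Y h x θ') / 2
        - (∑ l, (∑ j, θ j * p l j - ∑ j, θ' j * p l j) ^ 2 * w l) / 4 := by
    change ∑ l, (Y l - ∑ j, η j * p l j) ^ 2 * w l
      = ((∑ l, (Y l - ∑ j, θ j * p l j) ^ 2 * w l) + ∑ l, (Y l - ∑ j, θ' j * p l j) ^ 2 * w l) / 2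
        - (∑ l, (∑ j, θ j * p l j - ∑ j, θ' j * p l j) ^ 2 * w l) / 4
    rw [← Finset.sum_add_distrib, Finset.sum_div, Finset.sum_div, ← Finset.sum_sub_distrib]
    exact Finset.sum_congr rfl fun l _ => by rw [e1]; ring
  have m1 := isMinOn_iff.1 hθ η (mem_univ _)
  have m2 := isMinOn_iff.1 hθ' η (mem_univ _)
  have hle : (∑ l, (∑ j, θ j * p l j - ∑ j, θ' j * p l j) ^ 2 * w l) ≤ 0 := by linarith
  have hi : (∑ j, θ j * p i j - ∑ j, θ' j * p i j) ^ 2 * w i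
      ≤ ∑ l, (∑ j, θ j * p l j - ∑ j, θ' j * p l j) ^ 2 * w l :=
    Finset.single_le_sum (f := fun l => (∑ j, θ j * p l j - ∑ j, θ' j * p l j) ^ 2 * w l)
      (fun l _ => mul_nonneg (sq_nonneg _) (hK _)) (Finset.mem_univ i)
  have hwi : w i = K 0 := by simp [hw, hx]
  have hpi : p i = polyVec k 0 := by simp [hp, hx]
  rw [hwi, hpi] at hi
  have h0 : (∑ j, θ j * polyVec k 0 j - ∑ j, θ' j * polyVec k 0 j) ^ 2 ≤ 0 := by
    by_contra hc
    push Not at hc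
    have := mul_pos hc hK0
    linarith
  have h1 := pow_eq_zero_iff (two_ne_zero) |>.1 (le_antisymm h0 (sq_nonneg _))
  linarith

/-- The semi-metric `max_{i ∈ A} |g i - g' i|` between functions on the design points
(it is `0` if `A` is empty). -/
def dist {n : ℕ} (A : Finset (Fin n)) (g g' : Fin n → ℝ) : ℝ :=
  ((A.sup fun i => Real.nnabs (g i - g' i) : ℝ≥0) : ℝ)

/-- The local linear estimator (order one) with bandwidth `h`, evaluated at the design points. -/
def locLin (K : ℝ → ℝ) {n : ℕ} (Y : Fin n → ℝ) (h : ℝ) (i : Fin n) : ℝ := lpe K 1 Y h (design n i)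

/-- The candidate bandwidths `h_m = n⁻¹ 4^(m-1)`, for `m = 1, 2, …`. -/
def bandwidth (n m : ℕ) : ℝ := (n : ℝ)⁻¹ * 4 ^ ((m : ℤ) - 1)

/-- The number of candidate bandwidths: the integer part of
`(4/5) log₄ n + (1/5) log₄ log n`, but at least one (this matters only for `n ≤ 5`). -/
def gridSize (n : ℕ) : ℕ :=
  max 1 ⌊4 / 5 * Real.logb 4 n + 1 / 5 * Real.logb 4 (Real.log n)⌋₊

/-- `C_ρ = √(32 σ² μ₂ / λ₀²)`. -/
def Crho (K : ℝ → ℝ) (σ lam0 : ℝ) : ℝ := Real.sqrt (32 * σ ^ 2 * mu2 K / lam0 ^ 2)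

/-- `G₂(h) = C_ρ √(log n / (n h))`. -/
def G2 (K : ℝ → ℝ) (σ lam0 : ℝ) (n : ℕ) (h : ℝ) : ℝ :=
  Crho K σ lam0 * Real.sqrt (Real.log n / (n * h))

/-- The estimate with index `m` differs from one with a smaller index `k` by more than `4 κ G₂(h_k)`. -/
def Violates (K : ℝ → ℝ) (σ lam0 κ : ℝ) {n : ℕ} (A : Finset (Fin n)) (Y : Fin n → ℝ) (m : ℕ) : Prop :=
  ∃ k : ℕ, 1 ≤ k ∧ k < m ∧
    4 * κ * G2 K σ lam0 n (bandwidth n k)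
      < dist A (locLin K Y (bandwidth n k)) (locLin K Y (bandwidth n m))

open Classical in
/-- The stopping index of CALM: the first violating index in the grid minus one, or the last index of
the grid if there is no violation. -/
def stopIndex (K : ℝ → ℝ) (σ lam0 κ : ℝ) {n : ℕ} (A : Finset (Fin n)) (Y : Fin n → ℝ) : ℕ :=
  if H : ∃ m, m ≤ gridSize n ∧ Violates K σ lam0 κ A Y m then Nat.find H - 1 else gridSize n

/-- Independent centred Gaussian errors with variance `σ²`. -/
structure IsGaussianNoise {Ω : Type*} [MeasurableSpace Ω] (P : Measure Ω) (σ : ℝ) {n : ℕ}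
    (ε : Fin n → Ω → ℝ) : Prop where
  law : ∀ i, HasLaw (ε i) (gaussianReal 0 (σ ^ 2).toNNReal) P
  indep : iIndepFun ε P

/-- The observations `Y_i = f(x_i) + ε_i`. -/
def obs {Ω : Type*} {n : ℕ} (f : ℝ → ℝ) (ε : Fin n → Ω → ℝ) (ω : Ω) (i : Fin n) : ℝ :=
  f (design n i) + ε i ω

/-- The stochastic error `max_{i ∈ A} |f̂(x_i; h) - E f̂(x_i; h)|` of the local linear estimator. -/
def stochErr {Ω : Type*} [MeasurableSpace Ω] (P : Measure Ω) (K : ℝ → ℝ) {n : ℕ}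
    (A : Finset (Fin n)) (f : ℝ → ℝ) (ε : Fin n → Ω → ℝ) (h : ℝ) (ω : Ω) : ℝ :=
  dist A (locLin K (obs f ε ω) h) (fun i => ∫ ω', locLin K (obs f ε ω') h i ∂P)

end CALM

end

/-!
At a design point the local linear estimator is a linear smoother `∑ j, W j * Y j`, whatever the
bandwidth: its weights are those of the intercept in a weighted regression on one slope, they have
total mass one and annihilate the slope, and `∑ j, W j ^ 2 ≤ Kmax / Q`, where `Q` is the residual mass
of the constant one after projection on the slope (`locLin_eq_sum`, `sum_smoother_sq_le`). The only
place where the geometry of the design enters is the lower bound `Q ≥ q (n h + 1)` of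
`IsKernel.exists_localMass_ge`. For it the points on one side of `x_i` suffice, since the values of an
affine function with value one at the origin satisfy `2 g(l) - g(2 l) = 1` and cannot be small at
both `l` and `2 l`. It bounds the variance by a multiple of `σ² / (n h)` and the absolute mass of the
weights by a constant (`IsKernel.exists_smoother_bounds`).

The centred estimator is therefore sub-Gaussian, and a maximal inequality gives its second moment
(`lintegral_sq_sup_le`), a union bound its tails over the whole grid
(`IsGaussianNoise.measureReal_exists_noise_ge_le`). As `G₂` is inversely proportional to `lam0`, a
small `lam0` absorbs all the constants, those in the exponent of the tail bound included.

On the event that the stochastic errors stay below `κ G₂` the argument is deterministic. The bias is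
at most a multiple of `L h ^ β` (`abs_bias_le`), and vanishes for the smallest bandwidth
(`bias_mesh_eq_zero`). Let `m` be the last index up to which it is dominated by `κ G₂`. No index up to
`m` is in violation, so the rule stops at an index at or after `m` that was compared with `m`, and the
error is at most `6 κ G₂(h_m)` (`dist_stopIndex_le`). By maximality, `h_m` is at least of the order
`(log n / n) ^ (1 / (2 β + 1))`, uniformly in `β`, either because the bias is too large at the next
index or because the last bandwidth of the grid is of the optimal order for `β = 2`, which exceeds the
optimal orders for smaller `β`; this turns `G₂(h_m)` into the rate (`exists_oracleIndex`).
-/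

noncomputable section

namespace CALM

/-! ### Weighted least squares with an intercept and a slope -/

section LeastSquares

variable {ι : Type*} [Fintype ι]

/-- The ratio of the first to the second moment of the weights `w` at the nodes `u`. If the second
moment vanishes, then so does the first, and the convention `0 / 0 = 0` is the right one. -/
def tilt (w u : ι → ℝ) : ℝ := (∑ j, w j * u j) / ∑ j, w j * u j ^ 2

/-- The residual mass `∑ w (1 - t u)²` of the constant one after projection on the slope, for
`t = tilt w u`. -/
def resMass (w u : ι → ℝ) : ℝ := ∑ j, w j * (1 - tilt w u * u j) ^ 2

/-- The equivalent weights of the weighted linear fit: the fitted intercept for data `Y` is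
`∑ j, eqWeight w u j * Y j`. -/
def eqWeight (w u : ι → ℝ) (j : ι) : ℝ := w j * (1 - tilt w u * u j) / resMass w u

variable {w u : ι → ℝ}

/-- Division by the second moment can be undone even if it vanishes, because the numerator then
vanishes as well. -/
lemma div_secondMoment_mul (hw : ∀ j, 0 ≤ w j) (g : ι → ℝ) :
    (∑ j, w j * u j * g j) / (∑ j, w j * u j ^ 2) * (∑ j, w j * u j ^ 2)
      = ∑ j, w j * u j * g j := by
  by_cases h : ∑ j, w j * u j ^ 2 = 0
  · have h0 := (Finset.sum_eq_zero_iff_of_nonneg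
      (fun j _ => mul_nonneg (hw j) (sq_nonneg (u j)))).1 h
    have : ∑ j, w j * u j * g j = 0 := by
      refine Finset.sum_eq_zero fun j hj => ?_
      have := h0 j hj
      rcases mul_eq_zero.1 this with h1 | h1
      · simp [h1]
      · simp [pow_eq_zero_iff (two_ne_zero) |>.1 h1]
    rw [h, this]; simp
  · exact div_mul_cancel₀ _ h

lemma tilt_mul_secondMoment (hw : ∀ j, 0 ≤ w j) :
    tilt w u * (∑ j, w j * u j ^ 2) = ∑ j, w j * u j := by
  simpa [tilt] using div_secondMoment_mul (u := u) hw (fun _ => 1)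

lemma sum_tilted_mul_node (hw : ∀ j, 0 ≤ w j) :
    ∑ j, w j * (1 - tilt w u * u j) * u j = 0 := by
  have h := tilt_mul_secondMoment (u := u) hw
  have : ∑ j, w j * (1 - tilt w u * u j) * u j
      = ∑ j, w j * u j - tilt w u * ∑ j, w j * u j ^ 2 := by
    rw [Finset.mul_sum, ← Finset.sum_sub_distrib]
    exact Finset.sum_congr rfl fun j _ => by ring
  rw [this, h, sub_self]

lemma sum_tilted (hw : ∀ j, 0 ≤ w j) :
    ∑ j, w j * (1 - tilt w u * u j) = resMass w u := by
  have h := sum_tilted_mul_node (u := u) hw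
  have : resMass w u = ∑ j, w j * (1 - tilt w u * u j)
      - tilt w u * ∑ j, w j * (1 - tilt w u * u j) * u j := by
    rw [Finset.mul_sum, ← Finset.sum_sub_distrib, resMass]
    exact Finset.sum_congr rfl fun j _ => by ring
  rw [this, h]; ring

lemma sum_eqWeight (hw : ∀ j, 0 ≤ w j) (hQ : 0 < resMass w u) : ∑ j, eqWeight w u j = 1 := by
  simp only [eqWeight]
  rw [← Finset.sum_div, sum_tilted hw, div_self hQ.ne']

lemma sum_eqWeight_mul_node (hw : ∀ j, 0 ≤ w j) : ∑ j, eqWeight w u j * u j = 0 := by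
  have : ∑ j, eqWeight w u j * u j
      = (∑ j, w j * (1 - tilt w u * u j) * u j) / resMass w u := by
    rw [Finset.sum_div]
    exact Finset.sum_congr rfl fun j _ => by simp only [eqWeight]; ring
  rw [this, sum_tilted_mul_node hw, zero_div]

lemma sum_eqWeight_sq_le {b : ℝ} (hw : ∀ j, 0 ≤ w j) (hb : ∀ j, w j ≤ b)
    (hQ : 0 < resMass w u) : ∑ j, eqWeight w u j ^ 2 ≤ b / resMass w u := by
  have h : ∑ j, eqWeight w u j ^ 2
      ≤ ∑ j, b / resMass w u ^ 2 * (w j * (1 - tilt w u * u j) ^ 2) := by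
    refine Finset.sum_le_sum fun j _ => ?_
    have : eqWeight w u j ^ 2 = w j / resMass w u ^ 2 * (w j * (1 - tilt w u * u j) ^ 2) := by
      simp only [eqWeight]; ring
    rw [this]
    exact mul_le_mul_of_nonneg_right (by gcongr; exact hb j)
      (mul_nonneg (hw j) (sq_nonneg _))
  rw [← Finset.mul_sum] at h
  refine h.trans (le_of_eq ?_)
  change b / resMass w u ^ 2 * resMass w u = _
  field_simp

/-- Data whose residuals satisfy the normal equations are best fitted by the given line. -/
lemma sum_sq_le_of_normalEquations (hw : ∀ j, 0 ≤ w j) (Y : ι → ℝ) (a b a' b' : ℝ)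
    (h0 : ∑ j, w j * (Y j - (a + b * u j)) = 0)
    (h1 : ∑ j, w j * u j * (Y j - (a + b * u j)) = 0) :
    ∑ j, (Y j - (a + b * u j)) ^ 2 * w j ≤ ∑ j, (Y j - (a' + b' * u j)) ^ 2 * w j := by
  have key : ∑ j, (Y j - (a' + b' * u j)) ^ 2 * w j
      = ∑ j, (Y j - (a + b * u j)) ^ 2 * w j
        + 2 * (a - a') * ∑ j, w j * (Y j - (a + b * u j))
        + 2 * (b - b') * ∑ j, w j * u j * (Y j - (a + b * u j))
        + ∑ j, ((a - a') + (b - b') * u j) ^ 2 * w j := by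
    rw [Finset.mul_sum, Finset.mul_sum, ← Finset.sum_add_distrib, ← Finset.sum_add_distrib,
      ← Finset.sum_add_distrib]
    exact Finset.sum_congr rfl fun j _ => by ring
  have : 0 ≤ ∑ j, ((a - a') + (b - b') * u j) ^ 2 * w j :=
    Finset.sum_nonneg fun j _ => mul_nonneg (sq_nonneg _) (hw j)
  rw [key, h0, h1]; linarith

/-- The line with intercept `∑ W Y`, for `W` the equivalent weights, and a suitable slope is a best
fit, also if the second moment of the design vanishes. -/
lemma exists_slope_isMin (hw : ∀ j, 0 ≤ w j) (hQ : 0 < resMass w u) (Y : ι → ℝ) :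
    ∃ b : ℝ, ∀ a' b' : ℝ,
      ∑ j, (Y j - ((∑ l, eqWeight w u l * Y l) + b * u j)) ^ 2 * w j
        ≤ ∑ j, (Y j - (a' + b' * u j)) ^ 2 * w j := by
  set a := ∑ l, eqWeight w u l * Y l with ha
  set b := (∑ j, w j * u j * (Y j - a)) / ∑ j, w j * u j ^ 2 with hb
  have haQ : a * resMass w u = ∑ j, w j * (1 - tilt w u * u j) * Y j := by
    rw [ha, Finset.sum_mul]
    refine Finset.sum_congr rfl fun j _ => ?_
    simp only [eqWeight]; field_simp
  have h1 : ∑ j, w j * u j * (Y j - (a + b * u j)) = 0 := by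
    have e : ∑ j, w j * u j * (Y j - (a + b * u j))
        = ∑ j, w j * u j * (Y j - a) - b * ∑ j, w j * u j ^ 2 := by
      rw [Finset.mul_sum, ← Finset.sum_sub_distrib]
      exact Finset.sum_congr rfl fun j _ => by ring
    rw [e, hb, div_secondMoment_mul hw, sub_self]
  -- A combination of the normal equations isolates the intercept.
  have h0 : ∑ j, w j * (Y j - (a + b * u j)) = 0 := by
    have e : ∑ j, w j * (Y j - (a + b * u j))
        = ∑ j, w j * (1 - tilt w u * u j) * Y j - a * ∑ j, w j * (1 - tilt w u * u j)
          - b * ∑ j, w j * (1 - tilt w u * u j) * u j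
          + tilt w u * ∑ j, w j * u j * (Y j - (a + b * u j)) := by
      rw [Finset.mul_sum, Finset.mul_sum, Finset.mul_sum, ← Finset.sum_sub_distrib,
        ← Finset.sum_sub_distrib, ← Finset.sum_add_distrib]
      exact Finset.sum_congr rfl fun j _ => by ring
    rw [e, h1, sum_tilted_mul_node hw, sum_tilted hw, haQ]; ring
  exact ⟨b, fun a' b' => sum_sq_le_of_normalEquations hw Y a b a' b' h0 h1⟩

end LeastSquares

/-! ### The local linear estimator as a linear smoother -/

/-- The weight of the `j`-th observation in the local linear estimator at the `i`-th design
point. -/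
def smoother (K : ℝ → ℝ) (n : ℕ) (h : ℝ) (i j : Fin n) : ℝ :=
  eqWeight (fun l => K ((design n l - design n i) / h)) (fun l => (design n l - design n i) / h) j

/-- The residual mass of the local linear fit at the `i`-th design point. -/
def localMass (K : ℝ → ℝ) (n : ℕ) (h : ℝ) (i : Fin n) : ℝ :=
  resMass (fun l => K ((design n l - design n i) / h)) (fun l => (design n l - design n i) / h)

variable {K : ℝ → ℝ} {Kmax : ℝ}

lemma IsKernel.pos_zero (hK : IsKernel K Kmax) : 0 < K 0 := by
  obtain ⟨m, hm, D, hD, H⟩ := hK.lower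
  exact hm.trans_le (H 0 (by simpa using hD.le))

lemma IsKernel.Kmax_pos (hK : IsKernel K Kmax) : 0 < Kmax := hK.pos_zero.trans_le (hK.upper 0)

lemma IsKernel.continuous (hK : IsKernel K Kmax) : Continuous K := by
  obtain ⟨c, hc, H⟩ := hK.lipschitz
  refine (LipschitzWith.of_dist_le_mul (K := c.toNNReal) fun u v => ?_).continuous
  rw [Real.dist_eq, Real.dist_eq, Real.coe_toNNReal _ hc.le]
  exact H u v

/-- By continuity the kernel vanishes at the end points of its support as well. -/
lemma IsKernel.abs_lt_one (hK : IsKernel K Kmax) {u : ℝ} (hu : K u ≠ 0) : |u| < 1 := by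
  have hopen : IsOpen (Function.support K) := hK.continuous.isOpen_support
  have : u ∈ interior (Icc (-1 : ℝ) 1) := interior_maximal hK.support_subset hopen hu
  rw [interior_Icc] at this
  exact abs_lt.2 this

lemma localMass_pos (hK : IsKernel K Kmax) (n : ℕ) (h : ℝ) (i : Fin n) :
    0 < localMass K n h i := by
  have h1 := Finset.single_le_sum
    (f := fun l => K ((design n l - design n i) / h) *
      (1 - tilt (fun l => K ((design n l - design n i) / h))
        (fun l => (design n l - design n i) / h) * ((design n l - design n i) / h)) ^ 2)
    (fun l _ => mul_nonneg (hK.nonneg _) (sq_nonneg _)) (Finset.mem_univ i)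
  have h2 := hK.pos_zero
  simp only [sub_self, zero_div, mul_zero, sub_zero, one_pow, mul_one] at h1
  exact h2.trans_le h1

lemma locLin_eq_sum (hK : IsKernel K Kmax) {n : ℕ} (Y : Fin n → ℝ) (h : ℝ) (i : Fin n) :
    locLin K Y h i = ∑ j, smoother K n h i j * Y j := by
  obtain ⟨b, hb⟩ := exists_slope_isMin (w := fun l => K ((design n l - design n i) / h))
    (u := fun l => (design n l - design n i) / h) (fun _ => hK.nonneg _) (localMass_pos hK n h i) Y
  set θ : Fin 2 → ℝ := ![∑ j, smoother K n h i j * Y j, b] with hθ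
  have hmin : IsMinOn (lpeCriterion K 1 Y h (design n i)) univ θ := by
    refine isMinOn_iff.2 fun θ' _ => ?_
    have := hb (θ' 0) (θ' 1)
    simpa [lpeCriterion, polyVec, Fin.sum_univ_two, hθ, smoother] using this
  have hex : ∃ θ, IsMinOn (lpeCriterion K 1 Y h (design n i)) univ θ := ⟨θ, hmin⟩
  have hc : lpeCoeff K 1 Y h (design n i) = hex.choose := dif_pos hex
  rw [locLin, lpe, hc, lpe_value_unique K hK.nonneg hK.pos_zero 1 Y h i _ θ hex.choose_spec hmin]
  simp [polyVec, Fin.sum_univ_two, hθ]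

lemma sum_smoother (hK : IsKernel K Kmax) (n : ℕ) (h : ℝ) (i : Fin n) :
    ∑ j, smoother K n h i j = 1 :=
  sum_eqWeight (fun _ => hK.nonneg _) (localMass_pos hK n h i)

lemma sum_smoother_mul_sub (hK : IsKernel K Kmax) (n : ℕ) {h : ℝ} (hh : 0 < h) (i : Fin n) :
    ∑ j, smoother K n h i j * (design n j - design n i) = 0 := by
  have h1 := sum_eqWeight_mul_node (w := fun l => K ((design n l - design n i) / h))
    (u := fun l => (design n l - design n i) / h) (fun _ => hK.nonneg _)
  have h2 : ∑ j, smoother K n h i j * (design n j - design n i)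
      = h * ∑ j, smoother K n h i j * ((design n j - design n i) / h) := by
    rw [Finset.mul_sum]
    exact Finset.sum_congr rfl fun j _ => by field_simp
  rw [h2]
  unfold smoother
  rw [h1, mul_zero]

lemma abs_sub_lt_of_smoother_ne_zero (hK : IsKernel K Kmax) {n : ℕ} {h : ℝ} (hh : 0 < h)
    {i j : Fin n} (hj : smoother K n h i j ≠ 0) : |design n j - design n i| < h := by
  have : K ((design n j - design n i) / h) ≠ 0 := by
    intro h0
    exact hj (by simp [smoother, eqWeight, h0])
  have h1 := hK.abs_lt_one this
  rwa [abs_div, abs_of_pos hh, div_lt_one hh] at h1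

lemma sum_smoother_sq_le (hK : IsKernel K Kmax) (n : ℕ) (h : ℝ) (i : Fin n) :
    ∑ j, smoother K n h i j ^ 2 ≤ Kmax / localMass K n h i :=
  sum_eqWeight_sq_le (fun _ => hK.nonneg _) (fun _ => hK.upper _) (localMass_pos hK n h i)

lemma design_sub (n : ℕ) (i j : Fin n) :
    design n j - design n i = ((j : ℝ) - (i : ℝ)) / n := by
  simp only [design]; ring

lemma sum_comp_le_sum {α γ : Type*} [DecidableEq γ] {s : Finset α} {t : Finset γ} (φ : α → γ)
    (hφ : ∀ a ∈ s, φ a ∈ t) (hinj : Set.InjOn φ s) {g : γ → ℝ} (hg : ∀ c, 0 ≤ g c) :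
    ∑ a ∈ s, g (φ a) ≤ ∑ c ∈ t, g c := by
  rw [← Finset.sum_image (f := g) hinj]
  exact Finset.sum_le_sum_of_subset_of_nonneg (Finset.image_subset_iff.2 hφ) fun c _ _ => hg c

/-- The sum of a non-negative function over `m + 1` consecutive design points on one side of the
`i`-th one is at most the sum over all the points. -/
lemma exists_side_sum_le {n : ℕ} (i : Fin n) (m : ℕ) (hm : m ≤ (i : ℕ) ∨ (i : ℕ) + m < n)
    (g : ℝ → ℝ) (hg : ∀ x, 0 ≤ g x) :
    ∃ s : ℝ, |s| = 1 ∧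
      ∑ l ∈ Finset.range (m + 1), g (s * l / n) ≤ ∑ j, g (design n j - design n i) := by
  have hn : 0 < n := i.pos
  rcases hm with hm | hm
  · refine ⟨-1, by simp, ?_⟩
    have h := sum_comp_le_sum (s := Finset.range (m + 1)) (t := (Finset.univ : Finset (Fin n)))
      (fun l => (⟨(i : ℕ) - l, by omega⟩ : Fin n)) (fun _ _ => Finset.mem_univ _)
      (by
        intro a ha b hb hab
        simp only [Finset.coe_range, mem_Iio, Fin.mk.injEq] at ha hb hab
        omega)
      (g := fun j => g (design n j - design n i)) (fun _ => hg _)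
    refine le_trans (le_of_eq (Finset.sum_congr rfl fun l hl => ?_)) h
    have hl' : l ≤ (i : ℕ) := by have := Finset.mem_range.1 hl; omega
    congr 1
    rw [design_sub]
    push_cast [Nat.cast_sub hl']
    ring
  · refine ⟨1, by simp, ?_⟩
    have h := sum_comp_le_sum (s := Finset.range (m + 1)) (t := (Finset.univ : Finset (Fin n)))
      (fun l => (⟨((i : ℕ) + l) % n, Nat.mod_lt _ hn⟩ : Fin n)) (fun _ _ => Finset.mem_univ _)
      (by
        intro a ha b hb hab
        simp only [Finset.coe_range, mem_Iio, Fin.mk.injEq] at ha hb hab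
        rw [Nat.mod_eq_of_lt (by omega), Nat.mod_eq_of_lt (by omega)] at hab
        omega)
      (g := fun j => g (design n j - design n i)) (fun _ => hg _)
    refine le_trans (le_of_eq (Finset.sum_congr rfl fun l hl => ?_)) h
    have hl' : (i : ℕ) + l < n := by have := Finset.mem_range.1 hl; omega
    congr 1
    rw [design_sub]
    simp only [Nat.mod_eq_of_lt hl']
    push_cast
    ring

/-- An affine function equal to one at the origin cannot be small on `{0, …, 2 N}` in the mean: its
values `a` at `l` and `b` at `2 l` satisfy `2 a - b = 1`. -/
lemma le_sum_sq_affine (N : ℕ) (r : ℝ) :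
    ((N : ℝ) + 1) / 10 ≤ ∑ l ∈ Finset.range (2 * N + 1), (1 - r * (l : ℝ)) ^ 2 := by
  have h1 : ∑ l ∈ Finset.range (N + 1), (1 - r * (l : ℝ)) ^ 2
      ≤ ∑ l ∈ Finset.range (2 * N + 1), (1 - r * (l : ℝ)) ^ 2 :=
    Finset.sum_le_sum_of_subset_of_nonneg
      (Finset.range_subset_range.2 (by omega)) fun _ _ _ => sq_nonneg _
  have h2 := sum_comp_le_sum (s := Finset.range (N + 1)) (t := Finset.range (2 * N + 1))
    (fun l => 2 * l) (fun a ha => by simp only [Finset.mem_range] at ha ⊢; omega)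
    (fun a _ b _ hab => by simpa using hab)
    (g := fun l : ℕ => (1 - r * (l : ℝ)) ^ 2) (fun _ => sq_nonneg _)
  have h3 : ∑ l ∈ Finset.range (N + 1), (1 / 5 : ℝ)
      ≤ ∑ l ∈ Finset.range (N + 1),
        ((1 - r * (l : ℝ)) ^ 2 + (1 - r * ((2 * l : ℕ) : ℝ)) ^ 2) := by
    refine Finset.sum_le_sum fun l _ => ?_
    push_cast
    nlinarith [sq_nonneg (2 - 5 * (r * (l : ℝ)) + 1), sq_nonneg (5 * (r * (l : ℝ)) - 3)]
  rw [Finset.sum_add_distrib] at h3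
  simp only [Finset.sum_const, Finset.card_range, nsmul_eq_mul] at h3
  push_cast at h3 h2
  linarith

/-- The residual mass is of the order of the number of design points in the window, at the
boundary as well, and down to bandwidths below the mesh of the design. -/
lemma IsKernel.exists_localMass_ge (hK : IsKernel K Kmax) :
    ∃ q > 0, ∀ (n : ℕ) (h : ℝ), 0 < h → h ≤ 1 / 2 → ∀ i : Fin n,
      q * (n * h + 1) ≤ localMass K n h i := by
  obtain ⟨m, hm, D, hD, hlow⟩ := hK.lower
  set δ := min D 1 with hδ
  have hδ0 : 0 < δ := lt_min hD one_pos
  have hδ1 : δ ≤ 1 := min_le_right _ _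
  refine ⟨m * δ / 40, by positivity, fun n h hh hh2 i => ?_⟩
  have hn : (0 : ℝ) < n := by exact_mod_cast i.pos
  set N := ⌊n * h * δ / 2⌋₊ with hN
  have hN1 : (N : ℝ) ≤ n * h * δ / 2 := Nat.floor_le (by positivity)
  have hN2 : n * h * δ / 2 < N + 1 := Nat.lt_floor_add_one _
  have hside : 2 * N ≤ (i : ℕ) ∨ (i : ℕ) + 2 * N < n := by
    have h4 : (4 : ℝ) * N ≤ n := by
      have : n * h * δ ≤ n * (1 / 2) * 1 := by gcongr
      linarith
    have : 4 * N ≤ n := by exact_mod_cast h4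
    omega
  set t := tilt (fun l => K ((design n l - design n i) / h))
    (fun l => (design n l - design n i) / h) with ht
  obtain ⟨s, hs, hsum⟩ := exists_side_sum_le i (2 * N) hside
    (fun x => K (x / h) * (1 - t * (x / h)) ^ 2) (fun x => mul_nonneg (hK.nonneg _) (sq_nonneg _))
  have h1 : ∑ l ∈ Finset.range (2 * N + 1), m * (1 - t * s / (n * h) * (l : ℝ)) ^ 2
      ≤ localMass K n h i := by
    refine le_trans (Finset.sum_le_sum fun l hl => ?_) hsum
    have hl' : (l : ℝ) ≤ 2 * N := by
      have := Finset.mem_range.1 hl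
      exact_mod_cast (by omega : l ≤ 2 * N)
    have e : t * s / (n * h) * (l : ℝ) = t * (s * l / n / h) := by field_simp
    rw [e]
    refine mul_le_mul_of_nonneg_right (hlow _ ?_) (sq_nonneg _)
    rw [abs_div, abs_div, abs_mul, hs, one_mul, abs_of_pos hh, abs_of_pos hn, Nat.abs_cast,
      div_div, div_le_iff₀ (by positivity)]
    have : δ ≤ D := min_le_left _ _
    have : n * h * δ ≤ n * h * D := by gcongr
    linarith
  have h2 := le_sum_sq_affine N (t * s / (n * h))
  rw [← Finset.mul_sum] at h1
  have h3 := (mul_le_mul_of_nonneg_left h2 hm.le).trans h1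
  refine le_trans ?_ h3
  have h4 : δ / 40 * (n * h + 1) ≤ (N + 1) / 10 := by
    have : (0 : ℝ) ≤ N := Nat.cast_nonneg _
    nlinarith
  calc m * δ / 40 * (n * h + 1) = m * (δ / 40 * (n * h + 1)) := by ring
    _ ≤ _ := mul_le_mul_of_nonneg_left h4 hm.le

/-- A window of half-width `h` contains at most `2 n h + 1` design points. -/
lemma card_window_le (n : ℕ) {h : ℝ} (hh : 0 < h) (i : Fin n) :
    ((Finset.univ.filter fun j : Fin n => |design n j - design n i| < h).card : ℝ)
      ≤ 2 * (n * h) + 1 := by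
  have hn : (0 : ℝ) < n := by exact_mod_cast i.pos
  set N := ⌊n * h⌋₊ with hN
  have hcard : (Finset.univ.filter fun j : Fin n => |design n j - design n i| < h).card
      ≤ (Finset.Icc ((i : ℤ) - N) ((i : ℤ) + N)).card := by
    refine Finset.card_le_card_of_injOn (fun j => (j : ℤ)) (fun j hj => ?_) ?_
    · have hj' : |design n j - design n i| < h := by simpa using hj
      rw [design_sub, abs_div, abs_of_pos hn, div_lt_iff₀ hn] at hj'
      have h1 : ((j : ℤ) - (i : ℤ)).natAbs ≤ N := by
        refine Nat.le_floor ?_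
        rw [Nat.cast_natAbs]
        push_cast
        linarith
      simp only [Finset.coe_Icc, mem_Icc]
      omega
    · intro a _ b _ hab
      simpa [Fin.ext_iff] using hab
  have h2 : (Finset.Icc ((i : ℤ) - N) ((i : ℤ) + N)).card = 2 * N + 1 := by
    rw [Int.card_Icc]; omega
  rw [h2] at hcard
  have h3 : (N : ℝ) ≤ n * h := Nat.floor_le (by positivity)
  have h4 : ((Finset.univ.filter fun j : Fin n => |design n j - design n i| < h).card : ℝ)
      ≤ ((2 * N + 1 : ℕ) : ℝ) := by exact_mod_cast hcard
  push_cast at h4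
  linarith

/-- The variance factor and the absolute mass of the smoother are controlled by one constant. -/
lemma IsKernel.exists_smoother_bounds (hK : IsKernel K Kmax) :
    ∃ C > 0, ∀ (n : ℕ) (h : ℝ), 0 < h → h ≤ 1 / 2 → ∀ i : Fin n,
      ∑ j, smoother K n h i j ^ 2 ≤ C / (n * h) ∧ ∑ j, |smoother K n h i j| ≤ C + 1 := by
  obtain ⟨q, hq, H⟩ := hK.exists_localMass_ge
  have hKm := hK.Kmax_pos
  refine ⟨Kmax / q, by positivity, fun n h hh hh2 i => ?_⟩
  have hn : (0 : ℝ) < n := by exact_mod_cast i.pos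
  have hnh : 0 < n * h := by positivity
  have h1 : ∑ j, smoother K n h i j ^ 2 ≤ Kmax / (q * (n * h + 1)) :=
    (sum_smoother_sq_le hK n h i).trans
      (div_le_div_of_nonneg_left hKm.le (by positivity) (H n h hh hh2 i))
  refine ⟨h1.trans ?_, ?_⟩
  · rw [div_div]
    exact div_le_div_of_nonneg_left hKm.le (by positivity) (by gcongr; linarith)
  · set s := Finset.univ.filter fun j : Fin n => |design n j - design n i| < h with hs
    have h2 : ∑ j, |smoother K n h i j| = ∑ j ∈ s, |smoother K n h i j| := by
      symm
      refine Finset.sum_subset (Finset.subset_univ _) fun j _ hj => ?_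
      by_contra hne
      exact hj (by simpa [hs] using abs_sub_lt_of_smoother_ne_zero hK hh (by simpa using hne))
    have h3 : (∑ j ∈ s, |smoother K n h i j|) ^ 2
        ≤ s.card * ∑ j ∈ s, |smoother K n h i j| ^ 2 := sq_sum_le_card_mul_sum_sq
    have h4 : ∑ j ∈ s, |smoother K n h i j| ^ 2 ≤ ∑ j, smoother K n h i j ^ 2 := by
      simp only [sq_abs]
      exact Finset.sum_le_sum_of_subset_of_nonneg (Finset.subset_univ _) fun _ _ _ => sq_nonneg _
    have h5 : (∑ j, |smoother K n h i j|) ^ 2 ≤ (2 * (n * h) + 1) * (Kmax / (q * (n * h + 1))) := by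
      rw [h2]
      refine h3.trans (mul_le_mul (card_window_le n hh i) (h4.trans h1) ?_ (by positivity))
      exact Finset.sum_nonneg fun _ _ => sq_nonneg _
    have h6 : (2 * (n * h) + 1) * (Kmax / (q * (n * h + 1))) ≤ 2 * (Kmax / q) := by
      rw [← div_div, mul_div_assoc', div_le_iff₀ (by positivity)]
      have : 0 < Kmax / q := by positivity
      nlinarith
    -- `x² ≤ 2 C` implies `x ≤ C + 1`, as `2 x ≤ x² + 1`.
    nlinarith [sq_nonneg (∑ j, |smoother K n h i j| - 1), h5.trans h6,
      sq_nonneg (∑ j, |smoother K n h i j|), (by positivity : 0 < Kmax / q)]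

lemma IsKernel.mu2_pos (hK : IsKernel K Kmax) : 0 < mu2 K := by
  have hsupp : HasCompactSupport fun u => K u ^ 2 := by
    refine HasCompactSupport.intro (isCompact_Icc (a := (-1 : ℝ)) (b := 1)) fun x hx => ?_
    have : K x = 0 := by
      by_contra h
      exact hx (hK.support_subset h)
    simp [this]
  have hcont : Continuous fun u => K u ^ 2 := hK.continuous.pow 2
  exact hcont.integral_pos_of_hasCompactSupport_nonneg_nonzero hsupp (fun _ => sq_nonneg _)
    (x := 0) (by simpa using hK.pos_zero.ne')

/-! ### Maxima of sub-Gaussian variables -/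

section SubGaussian

variable {Ω : Type*} [MeasurableSpace Ω] {P : Measure Ω}

lemma hasSubgaussianMGF_of_hasLaw {X : Ω → ℝ} {v : ℝ≥0} (hX : HasLaw X (gaussianReal 0 v) P) :
    HasSubgaussianMGF X v P where
  integrable_exp_mul t := by
    have h := integrable_exp_mul_gaussianReal (μ := 0) (v := v) t
    rw [← hX.map_eq] at h
    exact h.comp_aemeasurable hX.aemeasurable
  mgf_le t := by rw [mgf_gaussianReal hX.map_eq]; simp

lemma hasSubgaussianMGF_mono {X : Ω → ℝ} {c d : ℝ≥0} (h : HasSubgaussianMGF X c P) (hcd : c ≤ d) :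
    HasSubgaussianMGF X d P where
  integrable_exp_mul := h.integrable_exp_mul
  mgf_le t := (h.mgf_le t).trans (by gcongr)

/-- A square is at most a threshold plus an exponentially small multiple of `e^{s z} + e^{-s z}`. -/
lemma sq_le_add_exp {s T : ℝ} (hs : 0 < s) (hT : 0 ≤ T) (z : ℝ) :
    z ^ 2 ≤ 2 * T ^ 2
      + 4 / s ^ 2 * Real.exp (-(s * T)) * (Real.exp (s * z) + Real.exp (-s * z)) := by
  have h1 : Real.exp (s * |z|) ≤ Real.exp (s * z) + Real.exp (-s * z) := by
    rcases abs_cases z with ⟨h, _⟩ | ⟨h, _⟩ <;> rw [h]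
    · exact le_add_of_nonneg_right (Real.exp_pos _).le
    · rw [mul_neg, neg_mul]; exact le_add_of_nonneg_left (Real.exp_pos _).le
  have h2 : 4 / s ^ 2 * Real.exp (-(s * T)) * Real.exp (s * |z|)
      = 4 / s ^ 2 * Real.exp (s * (|z| - T)) := by
    rw [mul_assoc, ← Real.exp_add]; ring_nf
  have h3 : z ^ 2 ≤ 2 * T ^ 2 + 4 / s ^ 2 * Real.exp (s * (|z| - T)) := by
    rw [← sq_abs z]
    rcases le_total |z| T with h | h
    · have : 0 ≤ 4 / s ^ 2 * Real.exp (s * (|z| - T)) := by positivity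
      nlinarith [abs_nonneg z]
    · have h4 := Real.quadratic_le_exp_of_nonneg (mul_nonneg hs.le (sub_nonneg.2 h))
      have h5 : (s * (|z| - T)) ^ 2 / 2 ≤ Real.exp (s * (|z| - T)) := by
        have := mul_nonneg hs.le (sub_nonneg.2 h)
        linarith
      have h6 : 2 * (|z| - T) ^ 2 ≤ 4 / s ^ 2 * Real.exp (s * (|z| - T)) := by
        calc 2 * (|z| - T) ^ 2 = 4 / s ^ 2 * ((s * (|z| - T)) ^ 2 / 2) := by field_simp; ring
          _ ≤ _ := by gcongr
      nlinarith [sq_nonneg (|z| - 2 * T)]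
  refine h3.trans ?_
  rw [← h2]
  gcongr

/-- The maximum of at most `n` sub-Gaussian variables has a second moment of order `log n`. -/
lemma lintegral_sq_sup_le [IsProbabilityMeasure P] {ι : Type*} (A : Finset ι) {Z : ι → Ω → ℝ}
    {c : ℝ≥0} (hc : 0 < c) (hZ : ∀ i, HasSubgaussianMGF (Z i) c P) {n : ℕ} (hn : 2 ≤ n)
    (hA : A.card ≤ n) :
    ∫⁻ ω, ENNReal.ofReal (((A.sup fun i => Real.nnabs (Z i ω) : ℝ≥0) : ℝ) ^ 2) ∂P
      ≤ ENNReal.ofReal (13 * c * Real.log n) := by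
  have hn0 : (0 : ℝ) < n := by exact_mod_cast (by omega : 0 < n)
  have hlog2 : (0.69 : ℝ) ≤ Real.log n := by
    have h2 : Real.log 2 ≤ Real.log n := Real.log_le_log two_pos (by exact_mod_cast hn)
    linarith [Real.log_two_gt_d9]
  set l := Real.log n with hl
  have hl0 : 0 < l := by linarith
  have hc' : (0 : ℝ) < c := by exact_mod_cast hc
  -- With this `s` and `T`, the exponential moments contribute a factor `n`, the union bound
  -- another one, and `e^{-s T} = n⁻²` compensates both.
  set s := Real.sqrt (2 * l / c) with hs
  have hs0 : 0 < s := Real.sqrt_pos.2 (by positivity)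
  have hs2 : s ^ 2 = 2 * l / c := Real.sq_sqrt (by positivity)
  set T := 2 * l / s with hT
  have hT0 : 0 ≤ T := by positivity
  have hsT : s * T = 2 * l := by rw [hT]; field_simp
  set a := 4 / s ^ 2 * Real.exp (-(s * T)) with ha
  have ha0 : 0 ≤ a := by positivity
  have hpt : ∀ ω, ((A.sup fun i => Real.nnabs (Z i ω) : ℝ≥0) : ℝ) ^ 2
      ≤ 2 * T ^ 2 + a * ∑ i ∈ A, (Real.exp (s * Z i ω) + Real.exp (-s * Z i ω)) := by
    intro ω
    have hnn : ∀ i, 0 ≤ Real.exp (s * Z i ω) + Real.exp (-s * Z i ω) := fun i => by positivity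
    rcases A.eq_empty_or_nonempty with rfl | hne
    · simp; positivity
    · obtain ⟨i, hi, hmax⟩ := A.exists_mem_eq_sup hne fun i => Real.nnabs (Z i ω)
      rw [hmax, Real.coe_nnabs, sq_abs]
      refine (sq_le_add_exp hs0 hT0 _).trans ?_
      gcongr
      exact Finset.single_le_sum (f := fun i => Real.exp (s * Z i ω) + Real.exp (-s * Z i ω))
        (fun i _ => hnn i) hi
  have hint : ∀ i, Integrable (fun ω => Real.exp (s * Z i ω) + Real.exp (-s * Z i ω)) P :=
    fun i => ((hZ i).integrable_exp_mul s).add ((hZ i).integrable_exp_mul (-s))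
  have hints : Integrable (fun ω => ∑ i ∈ A, (Real.exp (s * Z i ω) + Real.exp (-s * Z i ω))) P :=
    integrable_finsetSum _ fun i _ => hint i
  have hexp : (c : ℝ) * s ^ 2 / 2 = l := by rw [hs2]; field_simp
  have hmgf : ∀ i, ∫ ω, (Real.exp (s * Z i ω) + Real.exp (-s * Z i ω)) ∂P ≤ 2 * n := by
    intro i
    rw [integral_add ((hZ i).integrable_exp_mul s) ((hZ i).integrable_exp_mul (-s))]
    have h1 := (hZ i).mgf_le s
    have h2 := (hZ i).mgf_le (-s)
    rw [neg_sq] at h2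
    rw [hexp, hl, Real.exp_log hn0] at h1 h2
    simp only [mgf] at h1 h2
    linarith
  calc ∫⁻ ω, ENNReal.ofReal (((A.sup fun i => Real.nnabs (Z i ω) : ℝ≥0) : ℝ) ^ 2) ∂P
      ≤ ∫⁻ ω, ENNReal.ofReal (2 * T ^ 2
          + a * ∑ i ∈ A, (Real.exp (s * Z i ω) + Real.exp (-s * Z i ω))) ∂P :=
        lintegral_mono fun ω => ENNReal.ofReal_le_ofReal (hpt ω)
    _ = ENNReal.ofReal (∫ ω, (2 * T ^ 2
          + a * ∑ i ∈ A, (Real.exp (s * Z i ω) + Real.exp (-s * Z i ω))) ∂P) := by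
        rw [ofReal_integral_eq_lintegral_ofReal]
        · exact (integrable_const _).add (hints.const_mul a)
        · exact Filter.Eventually.of_forall fun ω => (sq_nonneg _).trans (hpt ω)
    _ ≤ ENNReal.ofReal (13 * c * l) := by
        refine ENNReal.ofReal_le_ofReal ?_
        rw [integral_add (integrable_const _) (hints.const_mul a), integral_const,
          integral_const_mul, integral_finsetSum _ fun i _ => hint i]
        simp only [probReal_univ, one_smul]
        have h1 : ∑ i ∈ A, ∫ ω, (Real.exp (s * Z i ω) + Real.exp (-s * Z i ω)) ∂P
            ≤ n * (2 * n) := by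
          refine (Finset.sum_le_sum fun i _ => hmgf i).trans ?_
          rw [Finset.sum_const, nsmul_eq_mul]
          gcongr
        have h2 : a * (n * (2 * n)) = 8 / s ^ 2 := by
          have : Real.exp (-(s * T)) = (n * n : ℝ)⁻¹ := by
            rw [hsT, Real.exp_neg, two_mul, Real.exp_add, hl, Real.exp_log hn0]
          rw [ha, this]; field_simp; norm_num
        have h3 : 2 * T ^ 2 = 4 * c * l := by
          rw [hT, div_pow, hs2]; field_simp; norm_num
        have h4 : 8 / s ^ 2 ≤ 9 * c * l := by
          rw [hs2, div_div_eq_mul_div, div_le_iff₀ (by positivity)]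
          have : 1 ≤ 9 / 4 * (l * l) := by nlinarith
          nlinarith
        have h5 := mul_le_mul_of_nonneg_left h1 ha0
        linarith

/-- The union bound for the two tails of finitely many sub-Gaussian variables. -/
lemma measureReal_exists_abs_ge_le {ι : Type*} [Finite ι] {Z : ι → Ω → ℝ}
    {c : ℝ≥0} (hZ : ∀ i, HasSubgaussianMGF (Z i) c P) [IsProbabilityMeasure P]
    {t : ℝ} (ht : 0 ≤ t) :
    P.real {ω | ∃ i, t ≤ |Z i ω|} ≤ Nat.card ι * (2 * Real.exp (-t ^ 2 / (2 * c))) := by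
  have := Fintype.ofFinite ι
  have h1 : {ω | ∃ i, t ≤ |Z i ω|} = ⋃ i, ({ω | t ≤ Z i ω} ∪ {ω | t ≤ (-Z i) ω}) := by
    ext ω; simp [le_abs]
  rw [h1]
  refine (measureReal_iUnion_fintype_le _).trans ?_
  rw [Nat.card_eq_fintype_card]
  refine (Finset.sum_le_card_nsmul _ _ (2 * Real.exp (-t ^ 2 / (2 * c))) fun i _ => ?_).trans
    (by simp)
  refine (measureReal_union_le _ _).trans ?_
  have h2 := (hZ i).measure_ge_le ht
  have h3 := (hZ i).neg.measure_ge_le ht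
  linarith

end SubGaussian

/-! ### The stochastic error -/

section Noise

variable {K : ℝ → ℝ} {Kmax : ℝ}
variable {Ω : Type*} {n : ℕ}

/-- The smoothed errors, that is the difference between the local linear estimator and its
expectation at the `i`-th design point. -/
def smoothedNoise (K : ℝ → ℝ) (ε : Fin n → Ω → ℝ) (h : ℝ) (i : Fin n) (ω : Ω) : ℝ :=
  ∑ j, smoother K n h i j * ε j ω

lemma locLin_obs (hK : IsKernel K Kmax) (f : ℝ → ℝ) (ε : Fin n → Ω → ℝ) (h : ℝ) (i : Fin n)
    (ω : Ω) : locLin K (obs f ε ω) h i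
      = ∑ j, smoother K n h i j * f (design n j) + smoothedNoise K ε h i ω := by
  rw [locLin_eq_sum hK, smoothedNoise, ← Finset.sum_add_distrib]
  exact Finset.sum_congr rfl fun j _ => by simp only [obs]; ring

variable [MeasurableSpace Ω] {P : Measure Ω} {ε : Fin n → Ω → ℝ} {σ : ℝ}

lemma IsGaussianNoise.hasSubgaussianMGF_smoothedNoise (hε : IsGaussianNoise P σ ε) {h : ℝ}
    {i : Fin n} {c : ℝ≥0} (hc : σ ^ 2 * ∑ j, smoother K n h i j ^ 2 ≤ c) :
    HasSubgaussianMGF (smoothedNoise K ε h i) c P := by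
  have h1 : ∀ j ∈ Finset.univ, HasSubgaussianMGF (fun ω => smoother K n h i j * ε j ω) _ P :=
    fun j _ => (hasSubgaussianMGF_of_hasLaw (hε.law j)).const_mul (smoother K n h i j)
  have hind : iIndepFun (fun j ω => smoother K n h i j * ε j ω) P :=
    hε.indep.comp (fun j x => smoother K n h i j * x) fun j => measurable_const_mul _
  refine hasSubgaussianMGF_mono (HasSubgaussianMGF.sum_of_iIndepFun hind h1) ?_
  rw [← NNReal.coe_le_coe]
  refine le_trans (le_of_eq ?_) hc
  push_cast
  rw [Finset.mul_sum]
  refine Finset.sum_congr rfl fun j _ => ?_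
  change smoother K n h i j ^ 2 * ((σ ^ 2).toNNReal : ℝ) = _
  rw [Real.coe_toNNReal _ (sq_nonneg σ), mul_comm]

lemma IsGaussianNoise.integral_locLin [IsProbabilityMeasure P] (hK : IsKernel K Kmax)
    (hε : IsGaussianNoise P σ ε) (f : ℝ → ℝ) (h : ℝ) (i : Fin n) :
    ∫ ω, locLin K (obs f ε ω) h i ∂P = ∑ j, smoother K n h i j * f (design n j) := by
  have hint : ∀ j, Integrable (ε j) P := fun j =>
    (hasSubgaussianMGF_of_hasLaw (hε.law j)).integrable
  have hmean : ∀ j, ∫ ω, ε j ω ∂P = 0 := fun j => by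
    rw [(hε.law j).integral_eq]; simp
  have hint' : Integrable (smoothedNoise K ε h i) P :=
    integrable_finsetSum _ fun j _ => (hint j).const_mul _
  have hzero : ∫ ω, smoothedNoise K ε h i ω ∂P = 0 := by
    unfold smoothedNoise
    rw [integral_finsetSum _ fun j _ => (hint j).const_mul _]
    exact Finset.sum_eq_zero fun j _ => by rw [integral_const_mul, hmean, mul_zero]
  simp only [locLin_obs hK]
  rw [integral_add (integrable_const _) hint', hzero]
  simp

lemma IsGaussianNoise.stochErr_eq [IsProbabilityMeasure P] (hK : IsKernel K Kmax)
    (hε : IsGaussianNoise P σ ε) (A : Finset (Fin n)) (f : ℝ → ℝ) (h : ℝ) (ω : Ω) :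
    stochErr P K A f ε h ω
      = ((A.sup fun i => Real.nnabs (smoothedNoise K ε h i ω) : ℝ≥0) : ℝ) := by
  simp only [stochErr, dist, hε.integral_locLin hK]
  simp only [locLin_obs hK, add_sub_cancel_left]

end Noise

/-! ### The bias over a Hölder class -/

section Bias

variable {K : ℝ → ℝ} {Kmax : ℝ} {n : ℕ}

/-- A function of Hölder order at most two differs from a suitable line through its graph by at most
`L |y - x| ^ β`. For `β ≤ 1` the line is horizontal, for `β > 1` it is the tangent. -/
lemma exists_slope_abs_sub_le {β L : ℝ} (hβ : 0 < β) (hβ2 : β ≤ 2) (hL : 0 ≤ L) {f : ℝ → ℝ}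
    (hf : f ∈ holderClass β L) {x : ℝ} (hx : x ∈ Icc (0 : ℝ) 1) :
    ∃ d : ℝ, ∀ y ∈ Icc (0 : ℝ) 1, |f y - f x - d * (y - x)| ≤ L * |y - x| ^ β := by
  obtain ⟨hf1, hf2⟩ := hf
  rcases le_or_gt β 1 with h1 | h1
  · have hc : ⌈β⌉₊ = 1 := by
      rw [Nat.ceil_eq_iff one_ne_zero]; simpa using ⟨hβ, h1⟩
    rw [hc] at hf2
    refine ⟨0, fun y hy => ?_⟩
    have := hf2 y hy x hx
    simpa using this
  · have hc : ⌈β⌉₊ = 2 := by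
      rw [Nat.ceil_eq_iff two_ne_zero]; push_cast; exact ⟨by linarith, hβ2⟩
    rw [hc] at hf1 hf2
    simp only [Nat.add_one_sub_one, iteratedDerivWithin_one] at hf2
    have hdiff : DifferentiableOn ℝ f (Icc 0 1) := hf1.differentiableOn (by simp)
    set d := derivWithin f (Icc 0 1) x with hd
    refine ⟨d, fun y hy => ?_⟩
    have hsub : uIcc x y ⊆ Icc (0 : ℝ) 1 := (convex_Icc (0 : ℝ) 1).ordConnected.uIcc_subset hx hy
    have hder : ∀ z ∈ uIcc x y, HasDerivWithinAt (fun z => f z - d * z)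
        (derivWithin f (Icc 0 1) z - d * 1) (uIcc x y) z := fun z hz =>
      (((hdiff z (hsub hz)).hasDerivWithinAt).mono hsub).sub
        ((hasDerivWithinAt_id z _).const_mul d)
    have hbd : ∀ z ∈ uIcc x y, ‖derivWithin f (Icc 0 1) z - d * 1‖ ≤ L * |y - x| ^ (β - 1) := by
      intro z hz
      rw [mul_one, Real.norm_eq_abs]
      have h2 := hf2 z (hsub hz) x hx
      refine h2.trans ?_
      rw [show β + 1 - ((2 : ℕ) : ℝ) = β - 1 by push_cast; ring]
      exact mul_le_mul_of_nonneg_left (Real.rpow_le_rpow (abs_nonneg _)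
        (abs_sub_left_of_mem_uIcc hz) (by linarith)) hL
    have h3 := (convex_uIcc x y).norm_image_sub_le_of_norm_hasDerivWithin_le hder hbd
      left_mem_uIcc right_mem_uIcc
    rw [Real.norm_eq_abs, Real.norm_eq_abs] at h3
    have e1 : f y - f x - d * (y - x) = f y - d * y - (f x - d * x) := by ring
    rw [e1]
    refine h3.trans (le_of_eq ?_)
    rcases eq_or_ne y x with rfl | hne
    · simp [Real.zero_rpow hβ.ne']
    · rw [mul_assoc, ← Real.rpow_add_one (by simpa [sub_eq_zero] using hne)]
      ring_nf

lemma design_mem (i : Fin n) : design n i ∈ Icc (0 : ℝ) 1 := by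
  have hn : (0 : ℝ) < n := by exact_mod_cast i.pos
  have hi : (i : ℝ) + 1 ≤ n := by exact_mod_cast i.isLt
  exact ⟨by unfold design; positivity, by unfold design; rwa [div_le_one hn]⟩

/-- The weights reproduce affine functions, so only the deviation of `f` from its line at `x_i`
contributes to the bias. -/
lemma abs_bias_le (hK : IsKernel K Kmax) {β L : ℝ} (hβ : 0 < β) (hβ2 : β ≤ 2) (hL : 0 ≤ L)
    {f : ℝ → ℝ} (hf : f ∈ holderClass β L) {h : ℝ} (hh : 0 < h) (i : Fin n) :
    |∑ j, smoother K n h i j * f (design n j) - f (design n i)|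
      ≤ (∑ j, |smoother K n h i j|) * (L * h ^ β) := by
  obtain ⟨d, hd⟩ := exists_slope_abs_sub_le hβ hβ2 hL hf (design_mem i)
  have e : ∑ j, smoother K n h i j * f (design n j) - f (design n i)
      = ∑ j, smoother K n h i j
        * (f (design n j) - f (design n i) - d * (design n j - design n i)) := by
    have e2 : ∑ j, smoother K n h i j
        * (f (design n j) - f (design n i) - d * (design n j - design n i))
        = ∑ j, smoother K n h i j * f (design n j) - (∑ j, smoother K n h i j) * f (design n i)
          - d * ∑ j, smoother K n h i j * (design n j - design n i) := by
      rw [Finset.sum_mul, Finset.mul_sum, ← Finset.sum_sub_distrib, ← Finset.sum_sub_distrib]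
      exact Finset.sum_congr rfl fun j _ => by ring
    rw [e2, sum_smoother hK, sum_smoother_mul_sub hK n hh]; ring
  rw [e, Finset.sum_mul]
  refine (Finset.abs_sum_le_sum_abs _ _).trans (Finset.sum_le_sum fun j _ => ?_)
  rw [abs_mul]
  by_cases h0 : smoother K n h i j = 0
  · simp [h0]
  · refine mul_le_mul_of_nonneg_left ((hd _ (design_mem j)).trans ?_) (abs_nonneg _)
    have := (abs_sub_lt_of_smoother_ne_zero hK hh h0).le
    gcongr

/-- A bandwidth equal to the mesh leaves only the observation at `x_i` itself. -/
lemma bias_mesh_eq_zero (hK : IsKernel K Kmax) (f : ℝ → ℝ) (i : Fin n) :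
    ∑ j, smoother K n (n : ℝ)⁻¹ i j * f (design n j) - f (design n i) = 0 := by
  have hn : (0 : ℝ) < n := by exact_mod_cast i.pos
  have e : ∑ j, smoother K n (n : ℝ)⁻¹ i j * f (design n j) - f (design n i)
      = ∑ j, smoother K n (n : ℝ)⁻¹ i j * (f (design n j) - f (design n i)) := by
    simp only [mul_sub, Finset.sum_sub_distrib]
    rw [← Finset.sum_mul, sum_smoother hK, one_mul]
  rw [e]
  refine Finset.sum_eq_zero fun j _ => ?_
  by_cases h0 : smoother K n (n : ℝ)⁻¹ i j = 0
  · rw [h0, zero_mul]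
  · have h1 := abs_sub_lt_of_smoother_ne_zero hK (inv_pos.2 hn) h0
    rw [design_sub, abs_div, abs_of_pos hn, div_lt_iff₀ hn, inv_mul_cancel₀ hn.ne'] at h1
    have h2 : |((j : ℤ) - (i : ℤ))| < 1 := by exact_mod_cast h1
    have h3 : j = i := by
      rw [Int.abs_lt_one_iff] at h2
      exact Fin.ext (by omega)
    rw [h3, sub_self, mul_zero]

end Bias

/-! ### The grid of bandwidths -/

section Grid

variable {n : ℕ}

lemma bandwidth_pos (hn : 0 < n) (m : ℕ) : 0 < bandwidth n m := by
  have : (0 : ℝ) < n := by exact_mod_cast hn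
  unfold bandwidth; positivity

lemma bandwidth_one : bandwidth n 1 = (n : ℝ)⁻¹ := by simp [bandwidth]

lemma bandwidth_succ (m : ℕ) : bandwidth n (m + 1) = 4 * bandwidth n m := by
  unfold bandwidth
  have : ((m + 1 : ℕ) : ℤ) - 1 = ((m : ℤ) - 1) + 1 := by push_cast; ring
  rw [this, zpow_add_one₀ (by norm_num)]; ring

lemma bandwidth_mono {k m : ℕ} (hkm : k ≤ m) : bandwidth n k ≤ bandwidth n m := by
  unfold bandwidth
  gcongr
  norm_num

lemma bandwidth_eq_rpow (m : ℕ) : bandwidth n m = (n : ℝ)⁻¹ * (4 : ℝ) ^ ((m : ℝ) - 1) := by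
  unfold bandwidth
  rw [← Real.rpow_intCast]; push_cast; rfl

lemma log_cast_pos (hn : 2 ≤ n) : 0 < Real.log n := Real.log_pos (by exact_mod_cast hn)

lemma log_div_pos (hn : 2 ≤ n) : 0 < Real.log n / n :=
  div_pos (log_cast_pos hn) (by exact_mod_cast (by omega : 0 < n))

lemma log_div_le_one (n : ℕ) : Real.log n / n ≤ 1 :=
  div_le_one_of_le₀ (Real.log_le_self (Nat.cast_nonneg n)) (Nat.cast_nonneg n)

/-- At the real number `y` whose integer part cuts off the grid, four times the bandwidth
`n⁻¹ 4 ^ (y - 1)` is the order of the optimal bandwidth for `β = 2`. -/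
lemma inv_mul_rpow_gridIndex (hn : 2 ≤ n) :
    (n : ℝ)⁻¹ * (4 : ℝ) ^ (4 / 5 * Real.logb 4 n + 1 / 5 * Real.logb 4 (Real.log n))
      = (Real.log n / n) ^ (1 / 5 : ℝ) := by
  have hn0 : (0 : ℝ) < n := by exact_mod_cast (by omega : 0 < n)
  have hl := log_cast_pos hn
  rw [Real.rpow_add (by norm_num), mul_comm (4 / 5 : ℝ), mul_comm (1 / 5 : ℝ),
    Real.rpow_mul (by norm_num), Real.rpow_mul (by norm_num),
    Real.rpow_logb (by norm_num) (by norm_num) hn0, Real.rpow_logb (by norm_num) (by norm_num) hl,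
    Real.div_rpow hl.le hn0.le]
  have : (n : ℝ)⁻¹ * (n : ℝ) ^ (4 / 5 : ℝ) = ((n : ℝ) ^ (1 / 5 : ℝ))⁻¹ := by
    rw [← Real.rpow_neg_one, ← Real.rpow_neg hn0.le, ← Real.rpow_add hn0]; norm_num
  rw [← mul_assoc, this]; ring

lemma rpow_le_bandwidth_gridSize (hn : 2 ≤ n) :
    (Real.log n / n) ^ (1 / 5 : ℝ) / 16 ≤ bandwidth n (gridSize n) := by
  have hn0 : (0 : ℝ) < n := by exact_mod_cast (by omega : 0 < n)
  rw [← inv_mul_rpow_gridIndex hn, bandwidth_eq_rpow, mul_div_assoc]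
  set y := 4 / 5 * Real.logb 4 n + 1 / 5 * Real.logb 4 (Real.log n) with hy
  have h1 : y < ⌊y⌋₊ + 1 := Nat.lt_floor_add_one y
  have h2 : (⌊y⌋₊ : ℝ) ≤ gridSize n := by exact_mod_cast le_max_right _ _
  have h3 : (4 : ℝ) ^ y / 16 = 4 ^ (y - 2) := by
    rw [Real.rpow_sub (by norm_num)]; norm_num
  rw [h3]
  refine mul_le_mul_of_nonneg_left ?_ (by positivity)
  exact Real.rpow_le_rpow_of_exponent_le (by norm_num) (by linarith)

lemma bandwidth_le_half (hn : 2 ≤ n) {m : ℕ} (hm : m ≤ gridSize n) : bandwidth n m ≤ 1 / 2 := by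
  have hn0 : (2 : ℝ) ≤ n := by exact_mod_cast hn
  refine (bandwidth_mono hm).trans ?_
  set y := 4 / 5 * Real.logb 4 n + 1 / 5 * Real.logb 4 (Real.log n) with hy
  rcases le_or_gt ⌊y⌋₊ 1 with h | h
  · have : gridSize n = 1 := max_eq_left h
    rw [this, bandwidth_one, one_div]
    gcongr
  · have e : gridSize n = ⌊y⌋₊ := max_eq_right h.le
    have h1 : (⌊y⌋₊ : ℝ) ≤ y := Nat.floor_le (Nat.pos_of_floor_pos (by omega)).le
    rw [bandwidth_eq_rpow, e]
    calc (n : ℝ)⁻¹ * (4 : ℝ) ^ ((⌊y⌋₊ : ℝ) - 1) ≤ (n : ℝ)⁻¹ * (4 : ℝ) ^ (y - 1) := by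
          gcongr; norm_num
      _ = (n : ℝ)⁻¹ * (4 : ℝ) ^ y / 4 := by rw [Real.rpow_sub (by norm_num)]; norm_num; ring
      _ = (Real.log n / n) ^ (1 / 5 : ℝ) / 4 := by rw [inv_mul_rpow_gridIndex hn]
      _ ≤ 1 / 4 := by
          gcongr
          exact Real.rpow_le_one (log_div_pos hn).le (log_div_le_one n) (by norm_num)
      _ ≤ 1 / 2 := by norm_num

lemma gridSize_le (hn : 2 ≤ n) : gridSize n ≤ n := by
  have hn0 : (0 : ℝ) < n := by exact_mod_cast (by omega : 0 < n)
  obtain ⟨M, hM⟩ : ∃ M, gridSize n = M + 1 := Nat.exists_eq_add_of_le' (le_max_left _ _)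
  have h := bandwidth_le_half hn le_rfl
  rw [hM, bandwidth, inv_mul_le_iff₀ hn0] at h
  have h1 : (4 : ℝ) ^ (((M + 1 : ℕ) : ℤ) - 1) = ((4 ^ M : ℕ) : ℝ) := by simp
  rw [h1] at h
  have h2 : ((4 ^ M : ℕ) : ℝ) ≤ n := by linarith
  have h3 : 4 ^ M ≤ n := by exact_mod_cast h2
  have h4 : M < 4 ^ M := Nat.lt_pow_self (by norm_num)
  omega

end Grid

/-! ### The stopping index and its oracle inequality -/

section Stopping

variable {K : ℝ → ℝ} {σ lam0 κ : ℝ} {n : ℕ} {A : Finset (Fin n)}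

lemma dist_le_iff {g g' : Fin n → ℝ} {c : ℝ} (hc : 0 ≤ c) :
    dist A g g' ≤ c ↔ ∀ i ∈ A, |g i - g' i| ≤ c := by
  lift c to ℝ≥0 using hc
  simp only [dist, NNReal.coe_le_coe, Finset.sup_le_iff]
  exact forall₂_congr fun i _ => by rw [← NNReal.coe_le_coe, Real.coe_nnabs]

lemma dist_nonneg (g g' : Fin n → ℝ) : 0 ≤ dist A g g' := NNReal.coe_nonneg _

lemma dist_comm (g g' : Fin n → ℝ) : dist A g g' = dist A g' g := by
  simp only [dist]
  congr 2
  ext i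
  simp [abs_sub_comm]

lemma dist_triangle (g g' g'' : Fin n → ℝ) : dist A g g'' ≤ dist A g g' + dist A g' g'' := by
  refine (dist_le_iff (add_nonneg (dist_nonneg _ _) (dist_nonneg _ _))).2 fun i hi => ?_
  have h1 := (dist_le_iff (dist_nonneg g g')).1 le_rfl i hi
  have h2 := (dist_le_iff (dist_nonneg g' g'')).1 le_rfl i hi
  exact (abs_sub_le _ _ _).trans (add_le_add h1 h2)

lemma G2_nonneg (h : ℝ) : 0 ≤ G2 K σ lam0 n h :=
  mul_nonneg (Real.sqrt_nonneg _) (Real.sqrt_nonneg _)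

lemma G2_bandwidth_anti (hn : 2 ≤ n) {k m : ℕ} (hkm : k ≤ m) :
    G2 K σ lam0 n (bandwidth n m) ≤ G2 K σ lam0 n (bandwidth n k) := by
  have h0 : (0 : ℝ) < n := by exact_mod_cast (by omega : 0 < n)
  have h1 := bandwidth_pos (n := n) (by omega) k
  have h2 := bandwidth_mono (n := n) hkm
  have h3 := (log_cast_pos hn).le
  unfold G2
  refine mul_le_mul_of_nonneg_left (Real.sqrt_le_sqrt ?_) (Real.sqrt_nonneg _)
  gcongr

/-- As long as the error at every index up to `m` is dominated by the stochastic level there, no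
index up to `m` is in violation; so the rule stops at `m` or later, at an index that was compared
with `m`. -/
lemma dist_stopIndex_le (hκ : 0 ≤ κ) (hn : 2 ≤ n) {Y g : Fin n → ℝ} {m : ℕ} (hm : 1 ≤ m)
    (hmM : m ≤ gridSize n)
    (herr : ∀ k, 1 ≤ k → k ≤ m →
      dist A g (locLin K Y (bandwidth n k)) ≤ 2 * κ * G2 K σ lam0 n (bandwidth n k)) :
    dist A g (locLin K Y (bandwidth n (stopIndex K σ lam0 κ A Y)))
      ≤ 6 * κ * G2 K σ lam0 n (bandwidth n m) := by
  have hviol : ∀ k, k ≤ m → ¬ Violates K σ lam0 κ A Y k := by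
    rintro k hk ⟨l, hl1, hlk, hlt⟩
    have h1 := herr l hl1 (by omega)
    have h2 := herr k (by omega) hk
    have h3 := dist_triangle (A := A) (locLin K Y (bandwidth n l)) g (locLin K Y (bandwidth n k))
    rw [dist_comm _ g] at h3
    have h4 := mul_le_mul_of_nonneg_left
      (G2_bandwidth_anti (K := K) (σ := σ) (lam0 := lam0) hn hlk.le) hκ
    linarith
  have hlate : m ≤ stopIndex K σ lam0 κ A Y
      ∧ ¬ Violates K σ lam0 κ A Y (stopIndex K σ lam0 κ A Y) := by
    classical
    unfold stopIndex
    split_ifs with H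
    · have hs := Nat.find_spec H
      have hlt : m < Nat.find H := by
        by_contra hle
        exact hviol _ (by omega) hs.2
      refine ⟨by omega, fun hv => Nat.find_min H (m := Nat.find H - 1) (by omega) ⟨?_, hv⟩⟩
      omega
    · exact ⟨hmM, fun hv => H ⟨_, le_rfl, hv⟩⟩
  obtain ⟨hge, hnv⟩ := hlate
  set s := stopIndex K σ lam0 κ A Y with hs
  have hG := mul_nonneg hκ (G2_nonneg (K := K) (σ := σ) (lam0 := lam0) (n := n) (bandwidth n m))
  have h1 := herr m hm le_rfl
  rcases hge.eq_or_lt with heq | hlt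
  · rw [← heq]; linarith
  · have h2 : dist A (locLin K Y (bandwidth n m)) (locLin K Y (bandwidth n s))
        ≤ 4 * κ * G2 K σ lam0 n (bandwidth n m) := by
      by_contra hc
      exact hnv ⟨m, hm, hlt, not_le.1 hc⟩
    have h3 := dist_triangle (A := A) g (locLin K Y (bandwidth n m)) (locLin K Y (bandwidth n s))
    linarith

/-- If the bias `B h ^ β` exceeds the stochastic level at the bandwidth `h`, then `h` is at least of
the order of the optimal bandwidth, with a constant that does not depend on `β`. -/
lemma le_of_stochastic_lt_bias {β B ρ h r : ℝ} (hβ : 0 < β) (hB : 0 < B) (hρ : 0 < ρ)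
    (hh : 0 < h) (hr : 0 < r) (hlt : ρ * Real.sqrt (r / h) < B * h ^ β) :
    min 1 (ρ / B) ^ 2 * r ^ (1 / (2 * β + 1)) ≤ h := by
  set c := min 1 (ρ / B) with hc
  have hc0 : 0 < c := lt_min one_pos (by positivity)
  have hc1 : c ≤ 1 := min_le_left _ _
  have hcρ : B * c ≤ ρ := by
    rw [mul_comm, ← le_div_iff₀ hB]; exact min_le_right _ _
  set x := r ^ (1 / (2 * β + 1)) with hx
  have hx0 : 0 < x := Real.rpow_pos_of_pos hr _
  by_contra! hcon
  have h1 : h ^ β ≤ x ^ β := by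
    refine Real.rpow_le_rpow hh.le (hcon.le.trans ?_) hβ.le
    have : c ^ 2 ≤ 1 := pow_le_one₀ hc0.le hc1
    nlinarith
  have h2 : Real.sqrt h ≤ c * Real.sqrt x := by
    calc Real.sqrt h ≤ Real.sqrt (c ^ 2 * x) := Real.sqrt_le_sqrt hcon.le
      _ = c * Real.sqrt x := by rw [Real.sqrt_mul (sq_nonneg c), Real.sqrt_sq hc0.le]
  have h3 : x ^ β * Real.sqrt x = Real.sqrt r := by
    rw [Real.sqrt_eq_rpow, Real.sqrt_eq_rpow, ← Real.rpow_add hx0, hx, ← Real.rpow_mul hr.le]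
    congr 1
    field_simp
  have h4 : ρ * Real.sqrt r < B * h ^ β * Real.sqrt h := by
    rwa [Real.sqrt_div hr.le, mul_div_assoc', div_lt_iff₀ (Real.sqrt_pos.2 hh)] at hlt
  have h5 : B * h ^ β * Real.sqrt h ≤ B * c * Real.sqrt r := by
    calc B * h ^ β * Real.sqrt h ≤ B * x ^ β * (c * Real.sqrt x) := by gcongr
      _ = B * c * (x ^ β * Real.sqrt x) := by ring
      _ = B * c * Real.sqrt r := by rw [h3]
  have h6 : B * c * Real.sqrt r ≤ ρ * Real.sqrt r :=
    mul_le_mul_of_nonneg_right hcρ (Real.sqrt_nonneg _)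
  linarith

/-- The oracle index: the last index of the grid up to which the bias stays below the stochastic
level. The first index is exempt because its bias vanishes. -/
lemma exists_oracleIndex (hR : 0 < Crho K σ lam0) (hκ : 0 < κ) {B : ℝ} (hB : 0 < B) :
    ∃ C > 0, ∀ β : ℝ, 0 < β → β ≤ 2 → ∀ n : ℕ, 2 ≤ n →
      ∃ m, 1 ≤ m ∧ m ≤ gridSize n ∧
        (∀ k, 1 < k → k ≤ m → B * bandwidth n k ^ β ≤ κ * G2 K σ lam0 n (bandwidth n k)) ∧
        6 * κ * G2 K σ lam0 n (bandwidth n m) ≤ C * (Real.log n / n) ^ (β / (2 * β + 1)) := by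
  set R := Crho K σ lam0 with hRdef
  set c := min 1 (κ * R / B) ^ 2 / 16 with hc
  have hmin : 0 < min 1 (κ * R / B) := lt_min one_pos (by positivity)
  have hc0 : 0 < c := by positivity
  refine ⟨6 * κ * R / Real.sqrt c, by positivity, fun β hβ hβ2 n hn => ?_⟩
  set r := Real.log n / n with hr
  have hr0 : 0 < r := log_div_pos hn
  have hG : ∀ h, G2 K σ lam0 n h = R * Real.sqrt (r / h) := fun h => by
    rw [G2, hr, div_div]
  set x := r ^ (1 / (2 * β + 1)) with hx
  have hx0 : 0 < x := Real.rpow_pos_of_pos hr0 _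
  -- It suffices that the chosen bandwidth is not smaller than the optimal one, up to a constant.
  have hrate : ∀ m, c * x ≤ bandwidth n m →
      6 * κ * G2 K σ lam0 n (bandwidth n m)
        ≤ 6 * κ * R / Real.sqrt c * r ^ (β / (2 * β + 1)) := by
    intro m hm
    have h1 : Real.sqrt (r / bandwidth n m) ≤ r ^ (β / (2 * β + 1)) / Real.sqrt c := by
      have h2 : r / x = (r ^ (β / (2 * β + 1))) ^ 2 := by
        rw [hx, ← Real.rpow_natCast, ← Real.rpow_mul hr0.le]
        nth_rewrite 1 [← Real.rpow_one r]
        rw [← Real.rpow_sub hr0]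
        congr 1
        push_cast
        field_simp
        ring
      calc Real.sqrt (r / bandwidth n m) ≤ Real.sqrt (r / (c * x)) := by
            apply Real.sqrt_le_sqrt; gcongr
        _ = Real.sqrt ((r ^ (β / (2 * β + 1))) ^ 2 / c) := by
            rw [← h2, div_div r x c, mul_comm c x]
        _ = _ := by rw [Real.sqrt_div (sq_nonneg _), Real.sqrt_sq (by positivity)]
    rw [hG]
    calc 6 * κ * (R * Real.sqrt (r / bandwidth n m))
        ≤ 6 * κ * (R * (r ^ (β / (2 * β + 1)) / Real.sqrt c)) := by gcongr
      _ = _ := by ring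
  have hM1 : 1 ≤ gridSize n := le_max_left _ _
  by_cases H : ∃ k, 1 < k ∧ k ≤ gridSize n ∧
      κ * G2 K σ lam0 n (bandwidth n k) < B * bandwidth n k ^ β
  · classical
    obtain ⟨h1, h2, h3⟩ := Nat.find_spec H
    obtain ⟨m, hm⟩ : ∃ m, Nat.find H = m + 1 := Nat.exists_eq_add_of_le' h1.le
    rw [hm] at h1 h2 h3
    refine ⟨m, by omega, by omega, fun k hk hkm => ?_, hrate m ?_⟩
    · by_contra hcon
      exact Nat.find_min H (m := k) (by omega) ⟨hk, by omega, not_le.1 hcon⟩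
    · rw [hG, ← mul_assoc] at h3
      have h4 := le_of_stochastic_lt_bias hβ hB (by positivity)
        (bandwidth_pos (by omega) _) hr0 h3
      rw [bandwidth_succ] at h4
      have h5 := bandwidth_pos (n := n) (by omega) m
      change min 1 (κ * R / B) ^ 2 * x ≤ _ at h4
      rw [hc]
      linarith
  · refine ⟨gridSize n, hM1, le_rfl, fun k hk hkm => ?_, hrate _ ?_⟩
    · by_contra hcon
      exact H ⟨k, hk, hkm, not_le.1 hcon⟩
    · refine le_trans ?_ (rpow_le_bandwidth_gridSize hn)
      have h1 : x ≤ r ^ (1 / 5 : ℝ) := by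
        refine Real.rpow_le_rpow_of_exponent_ge hr0 (log_div_le_one n) ?_
        exact one_div_le_one_div_of_le (by positivity) (by linarith)
      have h2 : min 1 (κ * R / B) ^ 2 ≤ 1 := pow_le_one₀ hmin.le (min_le_left _ _)
      calc c * x ≤ 1 / 16 * r ^ (1 / 5 : ℝ) := by rw [hc]; gcongr
        _ = _ := by ring

end Stopping

/-! ### The stochastic level and the two bounds -/

section Bounds

variable {K : ℝ → ℝ} {Kmax : ℝ}

lemma G2_sq {σ lam0 h : ℝ} {n : ℕ} (hK : IsKernel K Kmax) (hn : 2 ≤ n) (hh : 0 < h) :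
    G2 K σ lam0 n h ^ 2 = 32 * σ ^ 2 * mu2 K / lam0 ^ 2 * (Real.log n / (n * h)) := by
  have h1 := hK.mu2_pos
  have h2 := log_cast_pos hn
  rw [G2, Crho, mul_pow, Real.sq_sqrt (by positivity), Real.sq_sqrt (by positivity)]

/-- For a small enough `lam0`, the level `G₂²` dominates any prescribed multiple of `v log n`, where
`v` is the bound on the variance of the estimator. -/
lemma variance_mul_log_le_G2_sq {σ lam0 h C a : ℝ} {n : ℕ} (hK : IsKernel K Kmax) (hn : 2 ≤ n)
    (hh : 0 < h) (hlam0 : 0 < lam0) (hC : 0 < C) (ha : 0 < a)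
    (hlam : lam0 ≤ Real.sqrt (16 * mu2 K / (C * a))) :
    2 * a * (σ ^ 2 * (C / (n * h))) * Real.log n ≤ G2 K σ lam0 n h ^ 2 := by
  have h1 := hK.mu2_pos
  have h2 := log_cast_pos hn
  have h3 : lam0 ^ 2 ≤ 16 * mu2 K / (C * a) :=
    (Real.le_sqrt' hlam0).1 hlam
  rw [le_div_iff₀ (by positivity)] at h3
  have h4 : 2 * a * C ≤ 32 * mu2 K / lam0 ^ 2 := by
    rw [le_div_iff₀ (by positivity)]; linarith
  have h5 : 0 ≤ σ ^ 2 * (Real.log n / (n * h)) := by positivity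
  rw [G2_sq hK hn hh]
  calc 2 * a * (σ ^ 2 * (C / (n * h))) * Real.log n
      = 2 * a * C * (σ ^ 2 * (Real.log n / (n * h))) := by ring
    _ ≤ 32 * mu2 K / lam0 ^ 2 * (σ ^ 2 * (Real.log n / (n * h))) := by gcongr
    _ = _ := by ring

variable {Ω : Type*} {n : ℕ} {ε : Fin n → Ω → ℝ} {σ lam0 κ C a : ℝ}

/-- Outside the event that the smoothed errors exceed `κ G₂` somewhere, the error of the estimator
with a bandwidth whose bias is at most `κ G₂` is at most `2 κ G₂`. -/
lemma dist_locLin_le (hK : IsKernel K Kmax) (hκ : 0 ≤ κ) {A : Finset (Fin n)} {f : ℝ → ℝ} {h : ℝ}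
    {ω : Ω}
    (hbias : ∀ i, |∑ j, smoother K n h i j * f (design n j) - f (design n i)|
      ≤ κ * G2 K σ lam0 n h)
    (hnoise : ∀ i, |smoothedNoise K ε h i ω| ≤ κ * G2 K σ lam0 n h) :
    dist A (fun i => f (design n i)) (locLin K (obs f ε ω) h) ≤ 2 * κ * G2 K σ lam0 n h := by
  have hG := mul_nonneg hκ (G2_nonneg (K := K) (σ := σ) (lam0 := lam0) (n := n) h)
  refine (dist_le_iff (by linarith)).2 fun i _ => ?_
  have h1 := abs_le.1 (hbias i)
  have h2 := abs_le.1 (hnoise i)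
  rw [locLin_obs hK, abs_le]
  constructor <;> linarith [h1.1, h1.2, h2.1, h2.2]

variable [MeasurableSpace Ω] {P : Measure Ω}

/-- The variance bound of the estimator, as a sub-Gaussian parameter of the smoothed errors. -/
lemma IsGaussianNoise.hasSubgaussianMGF_of_bound (hε : IsGaussianNoise P σ ε) {h : ℝ} {i : Fin n}
    (hC : ∑ j, smoother K n h i j ^ 2 ≤ C / (n * h)) :
    HasSubgaussianMGF (smoothedNoise K ε h i) (σ ^ 2 * (C / (n * h))).toNNReal P :=
  hε.hasSubgaussianMGF_smoothedNoise
    ((mul_le_mul_of_nonneg_left hC (sq_nonneg σ)).trans (Real.le_coe_toNNReal _))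

variable [IsProbabilityMeasure P]

/-- Uniformly over the grid and over the design, the smoothed errors stay below `κ G₂` with high
probability. -/
lemma IsGaussianNoise.measureReal_exists_noise_ge_le (hK : IsKernel K Kmax)
    (hε : IsGaussianNoise P σ ε) (hσ : 0 < σ) (hn : 2 ≤ n) (hκ : 1 < κ) (hlam0 : 0 < lam0)
    (hC : 0 < C) (hCs : ∀ h : ℝ, 0 < h → h ≤ 1 / 2 → ∀ i : Fin n,
      ∑ j, smoother K n h i j ^ 2 ≤ C / (n * h)) (ha : 0 ≤ a)
    (hlam : lam0 ≤ Real.sqrt (16 * mu2 K / (C * (7 + a)))) :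
    P.real {ω | ∃ k ∈ Finset.Icc 1 (gridSize n), ∃ i,
        κ * G2 K σ lam0 n (bandwidth n k) ≤ |smoothedNoise K ε (bandwidth n k) i ω|}
      ≤ (n : ℝ) ^ (-a * (κ - 1) ^ 2) * Real.log n := by
  have hn0 : (0 : ℝ) < n := by exact_mod_cast (by omega : 0 < n)
  have hn2 : (2 : ℝ) ≤ n := by exact_mod_cast hn
  have hl := log_cast_pos hn
  have hset : {ω | ∃ k ∈ Finset.Icc 1 (gridSize n), ∃ i,
        κ * G2 K σ lam0 n (bandwidth n k) ≤ |smoothedNoise K ε (bandwidth n k) i ω|}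
      = ⋃ k ∈ Finset.Icc 1 (gridSize n), {ω | ∃ i,
        κ * G2 K σ lam0 n (bandwidth n k) ≤ |smoothedNoise K ε (bandwidth n k) i ω|} := by
    ext ω; simp
  set b := (n : ℝ) ^ (-(κ ^ 2 * (7 + a))) with hb
  have hone : ∀ k ∈ Finset.Icc 1 (gridSize n), P.real {ω | ∃ i,
        κ * G2 K σ lam0 n (bandwidth n k) ≤ |smoothedNoise K ε (bandwidth n k) i ω|}
      ≤ n * (2 * b) := by
    intro k hk
    have hh := bandwidth_pos (n := n) (by omega) k
    have hh2 := bandwidth_le_half hn (Finset.mem_Icc.1 hk).2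
    have h1 := measureReal_exists_abs_ge_le (P := P)
      (fun i => hε.hasSubgaussianMGF_of_bound (hCs _ hh hh2 i))
      (t := κ * G2 K σ lam0 n (bandwidth n k)) (mul_nonneg (by linarith) (G2_nonneg _))
    rw [Nat.card_eq_fintype_card, Fintype.card_fin] at h1
    refine h1.trans ?_
    set v := σ ^ 2 * (C / (n * bandwidth n k)) with hv
    have hv0 : 0 < v := by positivity
    have h2 := variance_mul_log_le_G2_sq (σ := σ) hK hn hh hlam0 hC (by linarith) hlam
    rw [← hv] at h2
    have h3 : Real.exp (-(κ * G2 K σ lam0 n (bandwidth n k)) ^ 2 / (2 * (v.toNNReal : ℝ))) ≤ b := by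
      rw [hb, Real.rpow_def_of_pos hn0, Real.coe_toNNReal _ hv0.le]
      refine Real.exp_le_exp.2 ?_
      rw [div_le_iff₀ (by positivity)]
      have := mul_le_mul_of_nonneg_left h2 (sq_nonneg κ)
      nlinarith
    gcongr
  have hsum : P.real {ω | ∃ k ∈ Finset.Icc 1 (gridSize n), ∃ i,
        κ * G2 K σ lam0 n (bandwidth n k) ≤ |smoothedNoise K ε (bandwidth n k) i ω|}
      ≤ n * (n * (2 * b)) := by
    rw [hset]
    refine (measureReal_biUnion_finset_le _ _).trans ((Finset.sum_le_card_nsmul _ _ _ hone).trans ?_)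
    rw [nsmul_eq_mul, Nat.card_Icc, Nat.add_sub_cancel]
    have : (gridSize n : ℝ) ≤ n := by exact_mod_cast gridSize_le hn
    have hb0 : 0 ≤ b := by positivity
    gcongr
  refine hsum.trans ?_
  -- The exponent splits as `κ² (7 + a) ≥ 7 + a (κ - 1)²`; the first part absorbs the union bound.
  have h4 : b ≤ (n : ℝ) ^ (-7 : ℝ) * (n : ℝ) ^ (-a * (κ - 1) ^ 2) := by
    rw [hb, ← Real.rpow_add hn0]
    refine Real.rpow_le_rpow_of_exponent_le (by linarith) ?_
    have h5 : 0 ≤ a * (2 * κ - 1) := mul_nonneg ha (by linarith)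
    nlinarith
  have h6 : (n : ℝ) * (n * (2 * (n : ℝ) ^ (-7 : ℝ))) ≤ Real.log n := by
    have h7 : (n : ℝ) ^ (-7 : ℝ) = ((n : ℝ) ^ 7)⁻¹ := by
      rw [Real.rpow_neg hn0.le]; norm_cast
    have h8 : (2 : ℝ) ^ 5 ≤ (n : ℝ) ^ 5 := by gcongr
    have h9 : (n : ℝ) * (n * (2 * (n : ℝ) ^ (-7 : ℝ))) = 2 / (n : ℝ) ^ 5 := by
      rw [h7]; field_simp
    have h10 : 2 / (n : ℝ) ^ 5 ≤ 1 / 2 := by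
      rw [div_le_iff₀ (by positivity)]; linarith
    have h11 : Real.log 2 ≤ Real.log n := Real.log_le_log two_pos hn2
    rw [h9]
    linarith [Real.log_two_gt_d9]
  have h12 : 0 ≤ (n : ℝ) ^ (-a * (κ - 1) ^ 2) := by positivity
  calc (n : ℝ) * (n * (2 * b))
      ≤ n * (n * (2 * ((n : ℝ) ^ (-7 : ℝ) * (n : ℝ) ^ (-a * (κ - 1) ^ 2)))) := by gcongr
    _ = (n : ℝ) ^ (-a * (κ - 1) ^ 2) * (n * (n * (2 * (n : ℝ) ^ (-7 : ℝ)))) := by ring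
    _ ≤ _ := mul_le_mul_of_nonneg_left h6 h12

end Bounds

end CALM

end

theorem mainTheorem5 (K : ℝ → ℝ) (Kmax : ℝ) (hK : CALM.IsKernel K Kmax) :
    ∃ lamK : ℝ, 0 < lamK ∧ ∀ lam0 : ℝ, 0 < lam0 → lam0 ≤ lamK → ∀ σ : ℝ, 0 < σ →
      -- `G₂²` bounds the second moment of the stochastic error
      (∀ n : ℕ, 2 ≤ n → ∀ h : ℝ, 0 < h → h ≤ 1 / 2 →
        ∀ (Ω : Type*) [MeasurableSpace Ω] (P : Measure Ω) [IsProbabilityMeasure P]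
          (ε : Fin n → Ω → ℝ), CALM.IsGaussianNoise P σ ε →
        ∀ (A : Finset (Fin n)) (f : ℝ → ℝ),
          ∫⁻ ω, ENNReal.ofReal (CALM.stochErr P K A f ε h ω ^ 2) ∂P
            ≤ ENNReal.ofReal (CALM.G2 K σ lam0 n h ^ 2)) ∧
      -- the adaptive estimator attains the rate of every Hölder class of order at most two
      (∀ κ : ℝ, 1 < κ → ∀ L : ℝ, 0 < L →
        ∃ Cmax : ℝ, 0 < Cmax ∧ ∀ β : ℝ, 0 < β → β ≤ 2 → ∀ n : ℕ, 2 ≤ n →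
          ∀ (Ω : Type*) [MeasurableSpace Ω] (P : Measure Ω) [IsProbabilityMeasure P]
            (ε : Fin n → Ω → ℝ), CALM.IsGaussianNoise P σ ε →
          ∀ A : Finset (Fin n), ∀ f ∈ CALM.holderClass β L,
            1 - (n : ℝ) ^ (-(CALM.mu2 K / (4 * Kmax ^ 2)) * (κ - 1) ^ 2) * Real.log n
              ≤ P.real {ω |
                  CALM.dist A (fun i => f (CALM.design n i))
                    (CALM.locLin K (CALM.obs f ε ω) (CALM.bandwidth n
                      (CALM.stopIndex K σ lam0 κ A (CALM.obs f ε ω))))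
                  ≤ Cmax * (Real.log n / n) ^ (β / (2 * β + 1))}) := by
  obtain ⟨C, hC, hS⟩ := hK.exists_smoother_bounds
  have hmu := hK.mu2_pos
  have hKm := hK.Kmax_pos
  set a := CALM.mu2 K / (4 * Kmax ^ 2) with ha
  have ha0 : 0 < a := by positivity
  -- The summand `7` leaves room for the constant of the maximal inequality and for the union bound
  -- over design points and bandwidths; the summand `a` is the exponent that is asked for.
  refine ⟨Real.sqrt (16 * CALM.mu2 K / (C * (7 + a))), Real.sqrt_pos.2 (by positivity),
    fun lam0 hlam0 hlam σ hσ => ⟨?_, ?_⟩⟩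
  · intro n hn h hh hh2 Ω _ P _ ε hε A f
    have hn0 : (0 : ℝ) < n := by exact_mod_cast (by omega : 0 < n)
    have hv0 : 0 < σ ^ 2 * (C / (n * h)) := by positivity
    simp only [hε.stochErr_eq hK]
    refine (CALM.lintegral_sq_sup_le A (Real.toNNReal_pos.2 hv0)
      (fun i => hε.hasSubgaussianMGF_of_bound (hS n h hh hh2 i).1) hn
      ((Finset.card_le_univ A).trans (by simp))).trans (ENNReal.ofReal_le_ofReal ?_)
    rw [Real.coe_toNNReal _ hv0.le]
    refine le_trans ?_
      (CALM.variance_mul_log_le_G2_sq hK hn hh hlam0 hC (by linarith : 0 < 7 + a) hlam)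
    have := CALM.log_cast_pos hn
    gcongr
    linarith
  · intro κ hκ L hL
    have hκ0 : 0 < κ := by linarith
    have hR : 0 < CALM.Crho K σ lam0 := Real.sqrt_pos.2 (by positivity)
    have hB : 0 < (C + 1) * L := by positivity
    obtain ⟨Cmax, hCmax, H⟩ := CALM.exists_oracleIndex hR hκ0 hB
    refine ⟨Cmax, hCmax, fun β hβ hβ2 n hn Ω _ P _ ε hε A f hf => ?_⟩
    obtain ⟨m, hm1, hmM, hgood, hrate⟩ := H β hβ hβ2 n hn
    set E := {ω | ∃ k ∈ Finset.Icc 1 (CALM.gridSize n), ∃ i,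
      κ * CALM.G2 K σ lam0 n (CALM.bandwidth n k)
        ≤ |CALM.smoothedNoise K ε (CALM.bandwidth n k) i ω|} with hE
    have hPE : P.real E ≤ (n : ℝ) ^ (-a * (κ - 1) ^ 2) * Real.log n :=
      hε.measureReal_exists_noise_ge_le hK hσ hn hκ hlam0 hC
        (fun h hh hh2 i => (hS n h hh hh2 i).1) ha0.le hlam
    set S := {ω | CALM.dist A (fun i => f (CALM.design n i))
        (CALM.locLin K (CALM.obs f ε ω) (CALM.bandwidth n
          (CALM.stopIndex K σ lam0 κ A (CALM.obs f ε ω))))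
      ≤ Cmax * (Real.log n / n) ^ (β / (2 * β + 1))} with hSdef
    have hcover : (univ : Set Ω) ⊆ E ∪ S := by
      intro ω _
      by_cases hω : ω ∈ E
      · exact Or.inl hω
      refine Or.inr ((CALM.dist_stopIndex_le hκ0.le hn hm1 hmM fun k hk1 hkm => ?_).trans hrate)
      refine CALM.dist_locLin_le hK hκ0.le (fun i => ?_) fun i => ?_
      · rcases hk1.eq_or_lt with rfl | hk
        · rw [CALM.bandwidth_one, CALM.bias_mesh_eq_zero hK, abs_zero]
          exact mul_nonneg hκ0.le (CALM.G2_nonneg _)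
        · have hh := CALM.bandwidth_pos (n := n) (by omega) k
          have hh2 := CALM.bandwidth_le_half hn (hkm.trans hmM)
          refine (CALM.abs_bias_le hK hβ hβ2 hL.le hf hh i).trans (le_trans ?_ (hgood k hk hkm))
          rw [mul_assoc]
          exact mul_le_mul_of_nonneg_right (hS n _ hh hh2 i).2 (by positivity)
      · by_contra hcon
        exact hω ⟨k, Finset.mem_Icc.2 ⟨hk1, hkm.trans hmM⟩, i, (not_le.1 hcon).le⟩
    have h1 : 1 ≤ P.real E + P.real S := by
      rw [← probReal_univ (μ := P)]
      exact (measureReal_mono hcover).trans (measureReal_union_le _ _)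
    linarith
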